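/- **Theorem.** Write $e(t) := e^{2\pi i t}$, let $d \ge 2$ be an integer and let $1<p<\infty$. For $C \in \mathbb{R}$, $A,B>0$ and integers $j \ge 1$, let $$X_j = X_j(C,A,B) := \Big\{ \frac{a}{q} : a \in \mathbb{Z},\ q \ge 1,\ (a,q)=1,\ q \le A j^{C} \Big\} + \big\{ \beta \in \mathbb{R} : |\beta| \le B j^{C} 2^{-dj} \big\} \subset \mathbb{R},$$ where $+$ denotes the Minkowski sum. For $\psi:\mathbb{R}\to\mathbb{R}$ put $\psi_j(x) := 2^{-j}\psi(2^{-j}x)$. There is a constant $C_0 = C_0(d,p)$ such that, for every $C \ge C_0$, all $A,B>0$ and every smooth, odd, compactly supported $\psi : \mathbb{R} \to \mathbb{R}$ (in particular, every such $\psi$ with $\frac1x \mathbf{1}_{|x|\ge 1} = \sum_{j \ge 1} \psi_j(x)\mathbf{1}_{|x|\ge 1}$), there is a constant $K = K(d,p,C,A,B,\psi)>0$ such that $$\Big\| \sup_{\lambda \in \mathbb{R} \setminus X_j(C,A,B')} \Big| \sum_{m \in \mathbb{Z}} f(x-m)\, \psi_j(m)\, e(-\lambda m^d) \Big| \Big\|_{\ell^p_x(\mathbb{Z})}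 \le K j^{-2} \|f\|_{\ell^p(\mathbb{Z})}$$ for all integers $j \ge 1$, all $B' \in [B, 2B]$ (which may depend on $j$) and all $f \in \ell^p(\mathbb{Z})$. Here the supremum over the empty set is $0$. -/

import Mathlib

open Set MeasureTheory
open scoped ENNReal ContDiff Pointwise

noncomputable section

/-- The character `e(t) = exp(2πit)`. -/
def charE (t : ℝ) : ℂ := Complex.exp (2 * Real.pi * Complex.I * t)

/-- The `L¹`-normalised dyadic dilate `ψ_j(x) = 2^{-j} ψ(2^{-j} x)`. -/
def dyadicDilate (ψ : ℝ → ℝ) (j : ℕ) (x : ℝ) : ℝ := ((2 : ℝ) ^ j)⁻¹ * ψ (((2 : ℝ) ^ j)⁻¹ * x)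

/-- The reduced rationals `a/q` with denominator `1 ≤ q ≤ N`. -/
def reducedFractions (N : ℝ) : Set ℝ :=
  {x | ∃ (a : ℤ) (q : ℕ), 1 ≤ q ∧ (q : ℝ) ≤ N ∧ IsCoprime a (q : ℤ) ∧ x = (a : ℝ) / (q : ℝ)}

/-- The set `X_j` of modulation parameters: the Minkowski sum of the reduced rationals with
denominator at most `A j^C` and of the interval `{|β| ≤ B j^C 2^{-dj}}`. -/
def exceptionalSet (d : ℕ) (C A B : ℝ) (j : ℕ) : Set ℝ :=
  reducedFractions (A * (j : ℝ) ^ C) + {β : ℝ | |β| ≤ B * (j : ℝ) ^ C * ((2 : ℝ) ^ (d * j))⁻¹}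

/-- The modulated single-scale average `∑_m f(x-m) ψ_j(m) e(-λ m^d)`. For compactly supported `ψ`
only finitely many terms are nonzero. -/
def modulatedSum (d : ℕ) (ψ : ℝ → ℝ) (j : ℕ) (l : ℝ) (f : ℤ → ℂ) (x : ℤ) : ℂ :=
  ∑' m : ℤ, f (x - m) * (dyadicDilate ψ j (m : ℝ) : ℂ) * charE (-(l * (m : ℝ) ^ d))

/-- The maximal function `sup_{λ ∉ X} |∑_m f(x-m) ψ_j(m) e(-λ m^d)|`, with values in `[0,∞]`. -/
def restrictedMaximal (d : ℕ) (ψ : ℝ → ℝ) (j : ℕ) (X : Set ℝ) (f : ℤ → ℂ) (x : ℤ) : ℝ≥0∞ :=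
  ⨆ l ∈ Xᶜ, ‖modulatedSum d ψ j l f x‖ₑ

end

/-! Choosing for each x a frequency λ(x) ∉ X_j that attains at least half of the supremum reduces
the claim to a linear operator whose frequency depends on x. Its kernel lives at scale N = 2^j, so
windows of length N suffice. With n = x' - x, the `TT*` kernel on a window is N⁻² times a sum over m
of a Lipschitz weight times e(λ(x)(m-n)^d - λ(x')m^d). Since λ(x') varies with no regularity, the
cancellation has to be extracted from λ(x) alone.

If such a sum exceeds N/Q, Weyl's inequality (`weyl_inverse`) puts its leading coefficient λ(x) -
λ(x') near a rational of small denominator q₁. Along progressions of difference q₁ the leading term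
then varies slowly and joins the weight. What remains has degree d-1 and top coefficient -dλ(x)n,
free of λ(x'). A second use of Weyl puts a small multiple of λ(x)n within Q^C N^{-(d-1)} of an
integer (`kernel_inverse`). If this happened for more than N/Q values of n, a recurrence argument
(`exists_nearInt_of_many_mul`) would gain one more factor N and place a small multiple of λ(x)
within Q^C N^{-d} of an integer, which λ(x) ∉ X_j forbids (`card_large_kernel_le`). So each row of
the kernel has few large entries, and Schur's test gives a power gain in ℓ² (`exists_schur_bound`).

Taking Q to be a large power of j and interpolating with the trivial bounds for entries O(1/N) gives
the gain j⁻² in ℓᵖ (`exists_window_gain`). Averaging over all windows makes it global; the finitely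
many small j are absorbed into the constant. -/

/-! ### Diophantine recurrence: many near-integers among the θh -/

/-- The real number `x` lies within `κ` of an integer. -/
def NearInt (κ x : ℝ) : Prop := ∃ b : ℤ, |x - b| ≤ κ

theorem NearInt.mono {κ κ' x : ℝ} (h : NearInt κ x) (hκ : κ ≤ κ') : NearInt κ' x :=
  let ⟨b, hb⟩ := h
  ⟨b, hb.trans hκ⟩

theorem NearInt.sub {κ κ' x y : ℝ} (hx : NearInt κ x) (hy : NearInt κ' y) :
    NearInt (κ + κ') (x - y) := by
  obtain ⟨b, hb⟩ := hx
  obtain ⟨c, hc⟩ := hy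
  refine ⟨b - c, ?_⟩
  rw [abs_le] at *
  push_cast
  constructor <;> linarith [hb.1, hb.2, hc.1, hc.2]

theorem NearInt.nonneg {κ x : ℝ} (h : NearInt κ x) : 0 ≤ κ :=
  let ⟨_, hb⟩ := h
  (abs_nonneg _).trans hb

/-- A dense set of integers in `[-N, N]` contains two elements congruent mod `q` whose
distance is at least `q n` and less than `q T`. -/
theorem exists_far_pair {N q T n : ℕ} {H : Finset ℤ} (hH : H ⊆ Finset.Icc (-(N : ℤ)) N)
    (hq : 1 ≤ q) (hT : 1 ≤ T) (hcard : q * (2 * (N / (q * T)) + 2) * n < H.card) :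
    ∃ h ∈ H, ∃ t : ℕ, h + q * t ∈ H ∧ n ≤ t ∧ t < T := by
  classical
  set W : ℕ := q * T with hW
  have hWpos : 0 < W := by positivity
  have hqpos : (0 : ℤ) < q := by exact_mod_cast hq
  have hWpos' : (0 : ℤ) < W := by exact_mod_cast hWpos
  set P : Finset (ℤ × ℤ) := Finset.Ico (0 : ℤ) q ×ˢ
    Finset.Icc (-((N / W : ℕ) : ℤ) - 1) ((N / W : ℕ) : ℤ) with hP
  have hPcard : P.card = q * (2 * (N / W) + 2) := by
    rw [hP, Finset.card_product, Int.card_Ico, Int.card_Icc]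
    congr 1; omega
  -- Pigeonhole over the residue mod q and the block of length qT. Two elements of one cell differ
  -- by qt with t < T, and a cell with more than n elements forces some t ≥ n.
  obtain ⟨c, -, hc⟩ := Finset.exists_lt_card_fiber_of_mul_lt_card_of_maps_to
    (s := H) (t := P) (f := fun h => (h % (q : ℤ), h / (W : ℤ))) (n := n)
    (by
      intro h hh
      have h1 := Finset.mem_Icc.1 (hH hh)
      simp only [hP, Finset.mem_product, Finset.mem_Ico, Finset.mem_Icc]
      refine ⟨⟨Int.emod_nonneg _ hqpos.ne', Int.emod_lt_of_pos _ hqpos⟩, ?_, ?_⟩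
      · have : (-(N : ℤ)) / W ≤ h / W := Int.ediv_le_ediv hWpos' h1.1
        refine le_trans ?_ this
        rw [Int.le_ediv_iff_mul_le hWpos']
        have h2 : (N : ℤ) < (N / W : ℕ) * W + W := by
          exact_mod_cast Nat.lt_div_mul_add hWpos
        nlinarith
      · push_cast
        exact Int.ediv_le_ediv hWpos' h1.2)
    (by rw [hPcard]; exact hcard)
  set F := H.filter (fun h => (h % (q : ℤ), h / (W : ℤ)) = c) with hF
  have hne : F.Nonempty := Finset.card_pos.1 (by omega)
  set h0 := F.min' hne with hh0
  have h0F : h0 ∈ F := Finset.min'_mem _ _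
  have key : ∀ h ∈ F, ∃ t : ℕ, h = h0 + q * t ∧ t < T := by
    intro h hh
    have hle : h0 ≤ h := Finset.min'_le _ _ hh
    have e1 := (Finset.mem_filter.1 hh).2
    have e0 := (Finset.mem_filter.1 h0F).2
    rw [← e0, Prod.mk.injEq] at e1
    obtain ⟨e1, e2⟩ := e1
    have hd : (q : ℤ) ∣ h - h0 := Int.ModEq.dvd (show h0 ≡ h [ZMOD q] from e1.symm)
    obtain ⟨t, ht⟩ := hd
    have ht0 : 0 ≤ t := by
      by_contra hneg
      push Not at hneg
      nlinarith
    lift t to ℕ using ht0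
    refine ⟨t, by linarith, ?_⟩
    have a1 := Int.emod_add_mul_ediv h W
    have a0 := Int.emod_add_mul_ediv h0 W
    rw [e2] at a1
    have b1 := Int.emod_lt_of_pos h hWpos'
    have b0 := Int.emod_nonneg h0 hWpos'.ne'
    have : (q : ℤ) * t < q * T := by
      have : (W : ℤ) = q * T := by rw [hW]; push_cast; ring
      linarith
    exact_mod_cast lt_of_mul_lt_mul_left this hqpos.le
  obtain ⟨h, hh, hfar⟩ : ∃ h ∈ F, h0 + q * n ≤ h := by
    by_contra hcon
    push Not at hcon
    have hsub : F ⊆ (Finset.range n).image (fun t : ℕ => h0 + (q : ℤ) * t) := by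
      intro h hh
      obtain ⟨t, ht, -⟩ := key h hh
      have := hcon h hh
      refine Finset.mem_image.2 ⟨t, Finset.mem_range.2 ?_, ht.symm⟩
      have h3 : (q : ℤ) * t < q * n := by linarith
      exact_mod_cast lt_of_mul_lt_mul_left h3 hqpos.le
    have := (Finset.card_le_card hsub).trans Finset.card_image_le
    rw [Finset.card_range] at this
    omega
  obtain ⟨t, ht, htT⟩ := key h hh
  refine ⟨h0, (Finset.mem_filter.1 h0F).1, t, ht ▸ (Finset.mem_filter.1 hh).1, ?_, htT⟩
  have h3 : (q : ℤ) * n ≤ q * t := by linarith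
  exact_mod_cast le_of_mul_le_mul_left h3 hqpos

/-- If `θ h` is close to an integer for many `h ∈ [-N, N]`, then a small multiple of `θ` is
extremely close to an integer. -/
theorem exists_nearInt_of_many {Q N : ℕ} {κ θ : ℝ} {H : Finset ℤ} (hQ : 2 ≤ Q)
    (hN : 128 * Q ^ 2 ≤ N) (hκ : κ * (256 * Q) ≤ 1) (hH : H ⊆ Finset.Icc (-(N : ℤ)) N)
    (hcard : N ≤ H.card * Q) (hnear : ∀ h ∈ H, NearInt κ (θ * h)) :
    ∃ q : ℕ, 1 ≤ q ∧ q ≤ 8 * Q ∧ NearInt (512 * Q ^ 2 * κ / N) (q * θ) := by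
  have hQ' : (2 : ℝ) ≤ Q := by exact_mod_cast hQ
  have hN' : 128 * (Q : ℝ) ^ 2 ≤ N := by exact_mod_cast hN
  have hNpos : (0 : ℝ) < N := by nlinarith
  -- First pass: two elements of H at distance less than 8Q. Their difference is the multiplier q,
  -- so far only with error 2κ.
  obtain ⟨h, hh, q, hhq, hq1, hq2⟩ := exists_far_pair (q := 1) (T := 8 * Q) (n := 1) hH le_rfl
    (by omega) (by
      rw [one_mul, one_mul, mul_one]
      by_contra hcon
      push Not at hcon
      have h1 : N / (8 * Q) * (8 * Q) ≤ N := Nat.div_mul_le_self _ _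
      have h2 : H.card * Q ≤ (2 * (N / (8 * Q)) + 2) * Q := Nat.mul_le_mul_right _ hcon
      nlinarith)
  have hκ0 : 0 ≤ κ := (hnear h hh).nonneg
  have hκ1 : κ * 512 ≤ 1 := by nlinarith
  have hdiff : NearInt (2 * κ) (q * θ) := by
    have := (hnear _ hhq).sub (hnear h hh)
    convert this using 1
    · ring
    · push_cast; ring
  refine ⟨q, hq1, hq2.le, ?_⟩
  obtain ⟨b, hb⟩ := hdiff
  refine ⟨b, ?_⟩
  set τ : ℝ := q * θ - b with hτ
  have hq1' : (1 : ℝ) ≤ q := by exact_mod_cast hq1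
  have hq2' : (q : ℝ) ≤ 8 * Q := by exact_mod_cast hq2.le
  -- Bootstrapping: a pair at distance qt with t comparable to T/Q also has error 2κ, now for tτ. As
  -- long as T|τ| ≤ 1/2 there is no wrap-around, so τ itself is O(Qκ/T).
  have key : ∀ T : ℕ, 8 * Q ≤ T → q * T ≤ N → T * |τ| ≤ 1 / 2 → T * |τ| ≤ 32 * Q * κ := by
    intro T hT8 hTN hTτ
    have hTpos : 0 < T := by omega
    obtain ⟨h, hh, t, hht, ht1, ht2⟩ := exists_far_pair (q := q) (T := T) (n := T / (8 * Q)) hH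
      hq1 hTpos (by
        by_contra hcon
        push Not at hcon
        have hW : 0 < q * T := by positivity
        have h1 : N / (q * T) * (q * T) ≤ N := Nat.div_mul_le_self _ _
        have h2 : T / (8 * Q) * (8 * Q) ≤ T := Nat.div_mul_le_self _ _
        have h3 : N ≤ q * (2 * (N / (q * T)) + 2) * (T / (8 * Q)) * Q :=
          hcard.trans (Nat.mul_le_mul_right _ hcon)
        have h4 : q * (2 * (N / (q * T)) + 2) * T ≤ 4 * N := by nlinarith
        have h5 : N * (8 * T) ≤ 4 * N * T := by
          calc N * (8 * T) ≤ q * (2 * (N / (q * T)) + 2) * (T / (8 * Q)) * Q * (8 * T) :=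
                Nat.mul_le_mul_right _ h3
            _ = (q * (2 * (N / (q * T)) + 2) * T) * (T / (8 * Q) * (8 * Q)) := by ring
            _ ≤ 4 * N * T := Nat.mul_le_mul h4 h2
        have : 0 < N * T := by
          have : 0 < N := by exact_mod_cast hNpos
          positivity
        nlinarith)
    obtain ⟨c, hc⟩ := (hnear _ hht).sub (hnear h hh)
    have e : θ * ((h + q * t : ℤ) : ℝ) - θ * h - c = t * τ - ((c - b * t : ℤ) : ℝ) := by
      rw [hτ]; push_cast; ring
    rw [e] at hc
    have htτ : |(t : ℝ) * τ| ≤ 1 / 2 := by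
      rw [abs_mul, Nat.abs_cast]
      have : (t : ℝ) ≤ T := by exact_mod_cast ht2.le
      exact (mul_le_mul_of_nonneg_right this (abs_nonneg _)).trans hTτ
    have hz : (c - b * t : ℤ) = 0 := by
      rw [← Int.abs_lt_one_iff]
      have : |((c - b * t : ℤ) : ℝ)| < 1 := by
        rw [abs_le] at hc htτ
        rw [abs_lt]
        constructor <;> linarith [hc.1, hc.2, htτ.1, htτ.2]
      exact_mod_cast this
    rw [hz, Int.cast_zero, sub_zero, abs_mul, Nat.abs_cast] at hc
    have hn : (T : ℝ) ≤ t * (16 * Q) := by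
      have h2 : T < T / (8 * Q) * (8 * Q) + 8 * Q := Nat.lt_div_mul_add (by omega)
      have h3 : 1 ≤ T / (8 * Q) := (Nat.one_le_div_iff (by omega)).2 hT8
      have : T ≤ t * (16 * Q) := by nlinarith
      exact_mod_cast this
    calc T * |τ| ≤ t * (16 * Q) * |τ| := mul_le_mul_of_nonneg_right hn (abs_nonneg _)
      _ = 16 * Q * (t * |τ|) := by ring
      _ ≤ 16 * Q * (κ + κ) := by gcongr
      _ = 32 * Q * κ := by ring
  by_cases hcase : ((N / q : ℕ) : ℝ) * |τ| ≤ 1 / 2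
  · have hlow : 8 * Q ≤ N / q := by
      rw [Nat.le_div_iff_mul_le hq1]
      nlinarith
    have h1 := key (N / q) hlow (Nat.mul_div_le _ _) hcase
    have h2 : (N : ℝ) ≤ (N / q : ℕ) * (2 * q) := by
      have h2 : N < N / q * q + q := Nat.lt_div_mul_add hq1
      have : N ≤ N / q * (2 * q) := by nlinarith
      exact_mod_cast this
    rw [le_div_iff₀ hNpos]
    calc |τ| * N ≤ |τ| * ((N / q : ℕ) * (2 * q)) := by gcongr
      _ = ((N / q : ℕ) * |τ|) * (2 * q) := by ring
      _ ≤ (32 * Q * κ) * (2 * (8 * Q)) := by gcongr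
      _ = 512 * Q ^ 2 * κ := by ring
  -- Otherwise T could be stopped with T|τ| just below 1/2, where `key` gives T|τ| ≤ 32Qκ ≤ 1/8.
  · exfalso
    push Not at hcase
    have hτpos : 0 < |τ| := by
      rcases (abs_nonneg τ).eq_or_lt with h0 | h0
      · rw [← h0] at hcase; norm_num at hcase
      · exact h0
    set T := ⌊1 / (2 * |τ|)⌋₊ with hTdef
    have hT1 : (T : ℝ) ≤ 1 / (2 * |τ|) := Nat.floor_le (by positivity)
    have hT2 : 1 / (2 * |τ|) < T + 1 := Nat.lt_floor_add_one _
    have hT1' : T * |τ| ≤ 1 / 2 := by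
      rw [le_div_iff₀ (by positivity)] at hT1; linarith
    have hT2' : 1 / 2 < (T + 1) * |τ| := by
      rw [div_lt_iff₀ (by positivity)] at hT2; linarith
    have hlow : 8 * Q ≤ T := by
      rw [hTdef, Nat.le_floor_iff (by positivity), le_div_iff₀ (by positivity)]
      push_cast
      nlinarith
    have hTN : q * T ≤ N := by
      have : T ≤ N / q := by
        by_contra hlt
        push Not at hlt
        have : ((N / q : ℕ) : ℝ) ≤ T := by exact_mod_cast hlt.le
        nlinarith
      exact (Nat.mul_le_mul_left _ this).trans (Nat.mul_div_le _ _)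
    have := key T hlow hTN hT1'
    nlinarith

/-- A version of `exists_nearInt_of_many` where an auxiliary bounded multiplier may depend on
the element `h`. -/
theorem exists_nearInt_of_many_mul {Q N : ℕ} {κ θ : ℝ} {H : Finset ℤ} (hQ : 2 ≤ Q)
    (hN : Q ^ 11 ≤ N) (hκ : κ * Q ^ 10 ≤ 1) (hH : H ⊆ Finset.Icc (-(N : ℤ)) N)
    (hcard : N ≤ H.card * Q)
    (hnear : ∀ h ∈ H, ∃ q : ℕ, 1 ≤ q ∧ q ≤ Q ∧ NearInt κ (q * (θ * h))) :
    ∃ q : ℕ, 1 ≤ q ∧ q ≤ Q ^ 13 ∧ NearInt (Q ^ 13 * κ / N) (q * θ) := by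
  classical
  have hNpos : 0 < N := lt_of_lt_of_le (by positivity) hN
  have hHne : H.Nonempty := by
    rw [← Finset.card_pos]
    by_contra h0
    have : H.card = 0 := by omega
    rw [this] at hcard
    omega
  have hκ0 : 0 ≤ κ := by
    obtain ⟨h, hh⟩ := hHne
    obtain ⟨q, -, -, hq⟩ := hnear h hh
    exact hq.nonneg
  choose! g hg1 hg2 hg3 using hnear
  -- Pigeonhole on the multiplier: one value of q serves a 1/Q share of H, so the density drops from
  -- 1/Q to 1/Q².
  obtain ⟨q, hqI, hq⟩ : ∃ q ∈ Finset.Icc 1 Q, N ≤ (H.filter (fun h => g h = q)).card * Q ^ 2 := by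
    by_contra hcon
    push Not at hcon
    have h1 : H.card = ∑ q ∈ Finset.Icc 1 Q, (H.filter (fun h => g h = q)).card :=
      Finset.card_eq_sum_card_fiberwise (fun h hh => by
        simpa using And.intro (hg1 h hh) (hg2 h hh))
    have h2 : H.card * Q ^ 2 < Q * N := by
      rw [h1, Finset.sum_mul]
      calc _ < ∑ q ∈ Finset.Icc 1 Q, N :=
            Finset.sum_lt_sum_of_nonempty ⟨1, by simp; omega⟩ hcon
        _ = Q * N := by simp
    nlinarith
  have hqI' := Finset.mem_Icc.1 hqI
  -- Since Q ≥ 2, the constants 128, 256 and 512 are traded for powers of Q.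
  have h64 : 2 ^ 7 ≤ Q ^ 7 := Nat.pow_le_pow_left hQ 7
  have h256 : 2 ^ 8 ≤ Q ^ 8 := Nat.pow_le_pow_left hQ 8
  have h512 : 2 ^ 9 ≤ Q ^ 9 := Nat.pow_le_pow_left hQ 9
  obtain ⟨r, hr1, hr2, hr⟩ := exists_nearInt_of_many (Q := Q ^ 2) (N := N) (κ := κ) (θ := q * θ)
    (H := H.filter (fun h => g h = q)) (by nlinarith)
    (le_trans (by
      calc 128 * (Q ^ 2) ^ 2 ≤ Q ^ 7 * (Q ^ 2) ^ 2 := Nat.mul_le_mul_right _ h64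
        _ = Q ^ 11 := by ring) hN)
    (le_trans (by
      have : (256 : ℝ) ≤ (Q : ℝ) ^ 8 := by exact_mod_cast h256
      push_cast
      calc κ * (256 * (Q : ℝ) ^ 2) ≤ κ * ((Q : ℝ) ^ 8 * (Q : ℝ) ^ 2) := by gcongr
        _ = κ * (Q : ℝ) ^ 10 := by ring) hκ)
    ((Finset.filter_subset _ _).trans hH) hq
    (by
      intro h hh
      obtain ⟨hh1, hh2⟩ := Finset.mem_filter.1 hh
      have := hg3 h hh1
      rw [hh2, ← mul_assoc] at this
      exact this)
  refine ⟨r * q, Nat.mul_pos hr1 hqI'.1, ?_, ?_⟩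
  · calc r * q ≤ 8 * Q ^ 2 * Q := Nat.mul_le_mul hr2 hqI'.2
      _ ≤ Q ^ 8 * Q ^ 2 * Q := by gcongr; omega
      _ = Q ^ 11 := by ring
      _ ≤ Q ^ 13 := Nat.pow_le_pow_right (by omega) (by norm_num)
  · push_cast
    rw [mul_assoc]
    refine hr.mono ?_
    have : (512 : ℝ) ≤ (Q : ℝ) ^ 9 := by exact_mod_cast h512
    push_cast
    have e : 512 * ((Q : ℝ) ^ 2) ^ 2 ≤ (Q : ℝ) ^ 13 := by
      calc 512 * ((Q : ℝ) ^ 2) ^ 2 ≤ (Q : ℝ) ^ 9 * ((Q : ℝ) ^ 2) ^ 2 := by gcongr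
        _ = (Q : ℝ) ^ 13 := by ring
    gcongr

/-! ### The character e(t) -/

theorem charE_add (s t : ℝ) : charE (s + t) = charE s * charE t := by
  unfold charE
  rw [← Complex.exp_add]
  push_cast
  ring_nf

theorem charE_intCast (b : ℤ) : charE b = 1 := by
  unfold charE
  rw [Complex.exp_eq_one_iff]
  exact ⟨b, by push_cast; ring⟩

theorem charE_eq_exp (t : ℝ) : charE t = Complex.exp (Complex.I * ((2 * Real.pi * t : ℝ) : ℂ)) := by
  unfold charE
  congr 1
  push_cast
  ring

theorem norm_charE (t : ℝ) : ‖charE t‖ = 1 := by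
  rw [charE_eq_exp, mul_comm, Complex.norm_exp_ofReal_mul_I]

theorem conj_charE (t : ℝ) : (starRingEnd ℂ) (charE t) = charE (-t) := by
  unfold charE
  rw [← Complex.exp_conj]
  congr 1
  simp [Complex.conj_ofReal, map_ofNat]

theorem charE_sub_intCast (t : ℝ) (b : ℤ) : charE (t - b) = charE t := by
  have := charE_add (t - b) b
  rw [charE_intCast, mul_one, sub_add_cancel] at this
  exact this.symm

theorem norm_charE_sub_one_le (t : ℝ) : ‖charE t - 1‖ ≤ 2 * Real.pi * |t| := by
  rw [charE_eq_exp]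
  refine (Real.norm_exp_I_mul_ofReal_sub_one_le).trans ?_
  rw [Real.norm_eq_abs, abs_mul, abs_of_pos (by positivity)]

/-- The chord has length 2|sin πβ| with β the signed distance to the nearest integer; Jordan's
inequality bounds the sine below. -/
theorem four_mul_abs_sub_round_le (t : ℝ) : 4 * |t - round t| ≤ ‖charE t - 1‖ := by
  rw [← charE_sub_intCast t (round t), charE_eq_exp, Complex.norm_exp_I_mul_ofReal_sub_one]
  have h := abs_sub_round t
  set β := t - round t
  have e : 2 * Real.pi * β / 2 = Real.pi * β := by ring
  have hπ := Real.pi_pos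
  have h1 : |Real.pi * β| ≤ Real.pi / 2 := by
    rw [abs_mul, abs_of_pos hπ]; nlinarith
  have h2 := Real.mul_abs_le_abs_sin h1
  rw [e, norm_mul, Real.norm_eq_abs, Real.norm_eq_abs, abs_two]
  rw [abs_mul, abs_of_pos hπ] at h2
  have : 2 / Real.pi * (Real.pi * |β|) = 2 * |β| := by field_simp
  linarith

/-! ### Polynomial phases through finite differences -/

/-- `PolyPhase k α φ` says that `φ : ℤ → ℝ` is a polynomial of degree at most `k` whose
coefficient in degree `k` is `α`, expressed through finite differences. -/
def PolyPhase : ℕ → ℝ → (ℤ → ℝ) → Prop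
  | 0, α, φ => ∀ m, φ m = α
  | k + 1, α, φ => ∀ h : ℤ, PolyPhase k ((k + 1) * α * h) (fun m => φ (m + h) - φ m)

theorem PolyPhase.add {k : ℕ} {α β : ℝ} {φ χ : ℤ → ℝ} (hφ : PolyPhase k α φ)
    (hχ : PolyPhase k β χ) : PolyPhase k (α + β) (fun m => φ m + χ m) := by
  induction k generalizing α β φ χ with
  | zero => intro m; simp only [hφ m, hχ m]
  | succ k ih =>
    intro h
    convert ih (hφ h) (hχ h) using 1
    · ring
    · funext m; ring

theorem PolyPhase.const_mul {k : ℕ} {α : ℝ} {φ : ℤ → ℝ} (c : ℝ) (hφ : PolyPhase k α φ) :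
    PolyPhase k (c * α) (fun m => c * φ m) := by
  induction k generalizing α φ with
  | zero => intro m; simp only [hφ m]
  | succ k ih =>
    intro h
    convert ih (hφ h) using 1
    · ring
    · funext m; ring

theorem PolyPhase.comp_affine {k : ℕ} {α : ℝ} {φ : ℤ → ℝ} (hφ : PolyPhase k α φ) (m q : ℤ) :
    PolyPhase k ((q : ℝ) ^ k * α) (fun t => φ (m + q * t)) := by
  induction k generalizing α φ with
  | zero => intro t; simp [hφ (m + q * t)]
  | succ k ih =>
    intro h
    convert ih (hφ (q * h)) using 1
    · push_cast; ring
    · funext t; ring_nf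

/-- Lets a lower-order remainder be added to a phase of higher degree without changing the leading
coefficient. -/
theorem PolyPhase.succ {k : ℕ} {α : ℝ} {φ : ℤ → ℝ} (hφ : PolyPhase k α φ) :
    PolyPhase (k + 1) 0 φ := by
  induction k generalizing α φ with
  | zero => intro h m; simp [hφ m, hφ (m + h)]
  | succ k ih =>
    intro h
    convert ih (hφ h) using 1
    ring

/-- Discrete Leibniz rule: the difference of mφ(m) is mΔφ(m) + hφ(m+h). The top coefficients (k+1)αh
and αh of the two terms add up to (k+2)αh. -/
theorem PolyPhase.id_mul {k : ℕ} {α : ℝ} {φ : ℤ → ℝ} (hφ : PolyPhase k α φ) :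
    PolyPhase (k + 1) α (fun m => m * φ m) := by
  induction k generalizing α φ with
  | zero =>
    intro h m
    simp only [hφ m, hφ (m + h)]
    push_cast; ring
  | succ k ih =>
    intro h
    have h1 := ih (hφ h)
    have h2 := (hφ.comp_affine h 1).const_mul h
    convert h1.add h2 using 1
    · push_cast; ring
    · funext m
      rw [one_mul, add_comm h m]
      push_cast; ring

theorem polyPhase_pow (k : ℕ) : PolyPhase k 1 (fun m => (m : ℝ) ^ k) := by
  induction k with
  | zero => intro m; simp
  | succ k ih =>
    convert ih.id_mul using 1
    funext m
    ring

/-! ### Weyl's inequality -/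

/-- Multiplying a geometric sum by e(α) - 1 telescopes it. The product form needs no exception for
integer α. -/
theorem norm_sum_Ico_mul_le {φ : ℤ → ℝ} {α : ℝ} (hφ : ∀ m, φ (m + 1) = φ m + α) (a b : ℤ) :
    ‖∑ t ∈ Finset.Ico a b, charE (φ t)‖ * ‖charE α - 1‖ ≤ 2 := by
  rcases le_or_gt a b with hab | hab
  · have key : ∀ n : ℕ, (∑ t ∈ Finset.Ico a (a + n), charE (φ t)) * (charE α - 1) =
        charE (φ (a + n)) - charE (φ a) := by
      intro n
      induction n with
      | zero => simp
      | succ n ih =>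
        have : Finset.Ico a (a + (n + 1 : ℕ)) = insert (a + n : ℤ) (Finset.Ico a (a + n)) := by
          ext x; simp only [Finset.mem_Ico, Finset.mem_insert]; omega
        rw [this, Finset.sum_insert (by simp), add_mul, ih]
        have e : φ (a + (n + 1 : ℕ)) = φ (a + n) + α := by
          rw [← hφ]; congr 1; push_cast; ring
        rw [e, charE_add]
        ring
    obtain ⟨n, rfl⟩ := Int.le.dest hab
    rw [← norm_mul, key]
    refine (norm_sub_le _ _).trans ?_
    rw [norm_charE, norm_charE]
    norm_num
  · rw [Finset.Ico_eq_empty (by omega)]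
    simp

/-- Weyl differencing over an interval of integers. -/
theorem norm_sum_Ico_sq_le (G : ℤ → ℂ) {a b : ℤ} {N : ℕ} (hab : b - a ≤ N) :
    ‖∑ t ∈ Finset.Ico a b, G t‖ ^ 2 ≤ ∑ h ∈ Finset.Icc (-(N : ℤ)) N,
      ‖∑ t ∈ Finset.Ico (max a (a - h)) (min b (b - h)), G (t + h) * (starRingEnd ℂ) (G t)‖ := by
  have e : ((∑ t ∈ Finset.Ico a b, G t) * (starRingEnd ℂ) (∑ t ∈ Finset.Ico a b, G t)) =
      ∑ h ∈ Finset.Icc (-(N : ℤ)) N,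
        ∑ t ∈ Finset.Ico (max a (a - h)) (min b (b - h)), G (t + h) * (starRingEnd ℂ) (G t) := by
    rw [map_sum, Finset.mul_sum]
    have h1 : ∀ h ∈ Finset.Icc (-(N : ℤ)) N,
        ∑ t ∈ Finset.Ico (max a (a - h)) (min b (b - h)), G (t + h) * (starRingEnd ℂ) (G t) =
        ∑ t ∈ Finset.Ico a b,
          if t + h ∈ Finset.Ico a b then G (t + h) * (starRingEnd ℂ) (G t) else 0 := by
      intro h _
      rw [← Finset.sum_filter]
      congr 1
      ext t
      simp only [Finset.mem_Ico, Finset.mem_filter]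
      omega
    rw [Finset.sum_congr rfl h1, Finset.sum_comm]
    refine Finset.sum_congr rfl fun t ht => ?_
    rw [Finset.mem_Ico] at ht
    rw [← Finset.sum_filter, Finset.sum_mul]
    symm
    refine Finset.sum_bij (fun h _ => t + h) ?_ ?_ ?_ ?_
    · intro h hh; exact (Finset.mem_filter.1 hh).2
    · intro h _ h' _ hh; simpa using hh
    · intro s hs
      rw [Finset.mem_Ico] at hs
      refine ⟨s - t, ?_, by ring⟩
      simp only [Finset.mem_filter, Finset.mem_Icc, Finset.mem_Ico]
      omega
    · intro h _; rfl
  have e2 : ‖∑ t ∈ Finset.Ico a b, G t‖ ^ 2 =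
      ‖(∑ t ∈ Finset.Ico a b, G t) * (starRingEnd ℂ) (∑ t ∈ Finset.Ico a b, G t)‖ := by
    rw [norm_mul, RCLike.norm_conj, sq]
  rw [e2, e]
  exact norm_sum_le _ _

/-- If the average of `g` over `[-N, N]` is large, then `g` is large at many points. -/
theorem card_large_of_sum {N Q : ℕ} (hQ : 2 ≤ Q) (hN : 1 ≤ N) {g : ℤ → ℝ}
    (hg : ∀ h, g h ≤ N) (hs : (N : ℝ) ^ 2 ≤ Q ^ 2 * ∑ h ∈ Finset.Icc (-(N : ℤ)) N, g h) :
    (N : ℝ) ≤ ((Finset.Icc (-(N : ℤ)) N).filter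
      (fun h => (N : ℝ) ≤ (Q : ℝ) ^ 4 * g h)).card * (Q : ℝ) ^ 4 := by
  classical
  set I := Finset.Icc (-(N : ℤ)) N
  set H := I.filter (fun h => (N : ℝ) ≤ (Q : ℝ) ^ 4 * g h)
  have hQ' : (2 : ℝ) ≤ Q := by exact_mod_cast hQ
  have hN' : (1 : ℝ) ≤ N := by exact_mod_cast hN
  have hQ4 : (0 : ℝ) < (Q : ℝ) ^ 4 := by positivity
  have hcard : (I.card : ℝ) = 2 * N + 1 := by
    have : I.card = 2 * N + 1 := by
      simp only [I, Int.card_Icc]; omega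
    rw [this]; push_cast; ring
  have h1 : ∑ h ∈ I, g h ≤ H.card * N + (2 * N + 1) * (N / (Q : ℝ) ^ 4) := by
    calc ∑ h ∈ I, g h ≤ ∑ h ∈ I, ((if (N : ℝ) ≤ (Q : ℝ) ^ 4 * g h then (N : ℝ) else 0)
          + N / (Q : ℝ) ^ 4) := by
          refine Finset.sum_le_sum fun h _ => ?_
          split_ifs with hc
          · have : 0 ≤ (N : ℝ) / (Q : ℝ) ^ 4 := by positivity
            linarith [hg h]
          · push Not at hc
            rw [zero_add, le_div_iff₀ hQ4]
            linarith
      _ = _ := by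
          rw [Finset.sum_add_distrib, ← Finset.sum_filter, Finset.sum_const, Finset.sum_const,
            nsmul_eq_mul, nsmul_eq_mul, hcard]
  have h2 : (N : ℝ) ^ 2 ≤ Q ^ 2 * (H.card * N + (2 * N + 1) * (N / (Q : ℝ) ^ 4)) :=
    hs.trans (by gcongr)
  have h3 : (N : ℝ) ^ 2 * Q ^ 2 ≤ H.card * N * Q ^ 4 + (2 * N + 1) * N := by
    calc (N : ℝ) ^ 2 * Q ^ 2 ≤ Q ^ 2 * (H.card * N + (2 * N + 1) * (N / (Q : ℝ) ^ 4)) * Q ^ 2 := by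
          gcongr
      _ = _ := by field_simp
  have h4 : (N : ℝ) * Q ^ 2 ≤ H.card * Q ^ 4 + (2 * N + 1) := by
    have : (N : ℝ) * (N * Q ^ 2) ≤ N * (H.card * Q ^ 4 + (2 * N + 1)) := by nlinarith
    exact le_of_mul_le_mul_left this (by linarith)
  -- As Q² ≥ 4, the left side of `h4` is at least 4N, and removing 2N + 1 leaves at least N.
  nlinarith [mul_le_mul_of_nonneg_left (show (4 : ℝ) ≤ Q ^ 2 by nlinarith)
    (show (0 : ℝ) ≤ N by linarith)]

/-- Weyl's inequality, in inverse form: a polynomial phase with a large exponential sum has a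
leading coefficient close to a rational with small denominator. -/
theorem weyl_inverse (k : ℕ) : ∃ C : ℕ, ∀ Q N : ℕ, 2 ≤ Q → Q ^ C ≤ N → ∀ (α : ℝ) (φ : ℤ → ℝ),
    PolyPhase (k + 1) α φ → ∀ a b : ℤ, b - a ≤ N →
      (N : ℝ) ≤ Q * ‖∑ t ∈ Finset.Ico a b, charE (φ t)‖ →
      ∃ q : ℕ, 1 ≤ q ∧ q ≤ Q ^ C ∧ NearInt ((Q : ℝ) ^ C / (N : ℝ) ^ (k + 1)) (q * α) := by
  induction k with
  | zero =>
    refine ⟨1, fun Q N hQ hN α φ hφ a b _ hs => ⟨1, le_rfl, by rw [pow_one]; omega, ?_⟩⟩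
    refine ⟨round α, ?_⟩
    have hNpos : (0 : ℝ) < N := by exact_mod_cast lt_of_lt_of_le (by positivity) hN
    have h1 := norm_sum_Ico_mul_le (φ := φ) (α := α)
      (fun m => by have := hφ 1 m; push_cast at this; linarith) a b
    have h2 := four_mul_abs_sub_round_le α
    set S := ‖∑ t ∈ Finset.Ico a b, charE (φ t)‖
    simp only [zero_add, pow_one, Nat.cast_one, one_mul]
    rw [le_div_iff₀ hNpos]
    have hS : 0 ≤ S := norm_nonneg _
    have h3 : S * (4 * |α - round α|) ≤ 2 := (mul_le_mul_of_nonneg_left h2 hS).trans h1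
    have hQ0 : (0 : ℝ) ≤ Q := Nat.cast_nonneg _
    calc |α - round α| * N ≤ |α - round α| * (Q * S) := by gcongr
      _ = Q * (S * |α - round α|) := by ring
      _ ≤ Q * 1 := by gcongr; linarith
      _ = Q := mul_one _
  | succ k ih =>
    obtain ⟨C, hC⟩ := ih
    -- The induction hypothesis is applied at Q⁴ and costs Q^{4C}; the set of good h has density
    -- Q⁻⁴. Both are covered by Q^D, which recurrence raises to the 13th power. The last summand k +
    -- 2 pays for the factor k + 2 created by differencing.
    set D := 4 * C + 4 with hD
    refine ⟨13 * D + 4 * C + (k + 2), fun Q N hQ hN α φ hφ a b hab hs => ?_⟩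
    have hQ1 : 1 ≤ Q := by omega
    have hN1 : 1 ≤ N := le_trans (Nat.one_le_pow _ _ (by omega)) hN
    have hQ' : (2 : ℝ) ≤ Q := by exact_mod_cast hQ
    have hQ1' : (1 : ℝ) ≤ Q := by linarith
    have hNpos : (0 : ℝ) < N := by exact_mod_cast hN1
    have hN1' : (1 : ℝ) ≤ N := by exact_mod_cast hN1
    set S := fun h : ℤ => ∑ t ∈ Finset.Ico (max a (a - h)) (min b (b - h)),
      charE (φ (t + h) - φ t) with hS
    have hdiff := norm_sum_Ico_sq_le (fun t => charE (φ t)) hab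
    have hS' : ∀ h, ∑ t ∈ Finset.Ico (max a (a - h)) (min b (b - h)),
        charE (φ (t + h)) * (starRingEnd ℂ) (charE (φ t)) = S h := by
      intro h
      refine Finset.sum_congr rfl fun t _ => ?_
      rw [conj_charE, ← charE_add, sub_eq_add_neg]
    simp only [hS'] at hdiff
    have hlen : ∀ h : ℤ, min b (b - h) - max a (a - h) ≤ N := by intro h; omega
    have hg : ∀ h, ‖S h‖ ≤ N := by
      intro h
      refine (norm_sum_le _ _).trans ?_
      simp only [norm_charE, Finset.sum_const, Int.card_Ico, nsmul_eq_mul, mul_one]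
      have : (min b (b - h) - max a (a - h)).toNat ≤ N := by have := hlen h; omega
      exact_mod_cast this
    have hcard := card_large_of_sum (g := fun h => ‖S h‖) hQ hN1 hg (by
      calc (N : ℝ) ^ 2 ≤ (Q * ‖∑ t ∈ Finset.Ico a b, charE (φ t)‖) ^ 2 := by gcongr
        _ = (Q : ℝ) ^ 2 * ‖∑ t ∈ Finset.Ico a b, charE (φ t)‖ ^ 2 := by ring
        _ ≤ _ := by gcongr)
    set H := (Finset.Icc (-(N : ℤ)) N).filter (fun h => (N : ℝ) ≤ (Q : ℝ) ^ 4 * ‖S h‖)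
    have hpw : ∀ {i : ℕ}, i ≤ 13 * D + 4 * C + (k + 2) → Q ^ i ≤ N := fun hi =>
      (Nat.pow_le_pow_right hQ1 hi).trans hN
    have hnear : ∀ h ∈ H, ∃ q : ℕ, 1 ≤ q ∧ q ≤ Q ^ D ∧
        NearInt ((Q : ℝ) ^ (4 * C) / (N : ℝ) ^ (k + 1)) (q * ((((k + 1 : ℕ) : ℝ) + 1) * α * h)) := by
      intro h hh
      obtain ⟨q, hq1, hq2, hq3⟩ := hC (Q ^ 4) N (by nlinarith [Nat.pow_le_pow_left hQ 4])
        (by rw [← pow_mul]; exact hpw (by omega)) _ _ (hφ h) _ _ (hlen h)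
        (by push_cast; exact (Finset.mem_filter.1 hh).2)
      refine ⟨q, hq1, hq2.trans ?_, ?_⟩
      · rw [← pow_mul]; exact Nat.pow_le_pow_right hQ1 (by omega)
      · rw [pow_mul]; push_cast at hq3 ⊢; exact hq3
    -- Recurrence in h, with θ = (k+2)α, removes the shift h and improves the error by a factor N.
    obtain ⟨q, hq1, hq2, hq3⟩ := exists_nearInt_of_many_mul (Q := Q ^ D) (N := N) (H := H)
      (hQ.trans (by
        calc Q = Q ^ 1 := (pow_one _).symm
          _ ≤ Q ^ D := Nat.pow_le_pow_right hQ1 (by omega)))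
      (by rw [← pow_mul]; exact hpw (by omega))
      (by
        push_cast
        rw [div_mul_eq_mul_div, div_le_one (by positivity), ← pow_mul, ← pow_add]
        calc (Q : ℝ) ^ (4 * C + D * 10) ≤ N := by exact_mod_cast hpw (by omega)
          _ = (N : ℝ) ^ 1 := (pow_one _).symm
          _ ≤ (N : ℝ) ^ (k + 1) := pow_le_pow_right₀ hN1' (by omega))
      (Finset.filter_subset _ _)
      (by
        have h4 : (Q : ℝ) ^ 4 ≤ (Q : ℝ) ^ D := pow_le_pow_right₀ hQ1' (by omega)
        have : (N : ℝ) ≤ H.card * (Q : ℝ) ^ D := hcard.trans (by gcongr)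
        exact_mod_cast this)
      hnear
    have hk : k + 2 ≤ Q ^ (k + 2) :=
      (Nat.lt_two_pow_self (n := k + 2)).le.trans (Nat.pow_le_pow_left hQ _)
    refine ⟨q * (k + 2), Nat.mul_pos hq1 (by omega), ?_, ?_⟩
    · calc q * (k + 2) ≤ (Q ^ D) ^ 13 * Q ^ (k + 2) := Nat.mul_le_mul hq2 hk
        _ = Q ^ (D * 13 + (k + 2)) := by rw [← pow_mul, ← pow_add]
        _ ≤ _ := Nat.pow_le_pow_right hQ1 (by omega)
    · have e : ((q * (k + 2) : ℕ) : ℝ) * α = q * ((((k + 1 : ℕ) : ℝ) + 1) * α) := by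
        push_cast; ring
      rw [e]
      refine hq3.mono ?_
      push_cast
      rw [← pow_mul, mul_div_assoc', ← pow_add, div_div, ← pow_succ]
      gcongr ?_ / _
      exact pow_le_pow_right₀ hQ1' (by omega)

/-! ### Freezing a slowly varying weight on progressions -/

/-- A sum of a slowly varying weight `W` against `z` is dominated by sums of `z` over short
progressions of difference `q`. -/
theorem exists_large_progression {W z : ℤ → ℂ} {S q L : ℕ} {B η V : ℝ}
    (hqL : q * L ≤ S) (hW : ∀ m, W m ≠ 0 → |m| ≤ S) (hB : ∀ m, ‖W m‖ ≤ B) (hz : ∀ m, ‖z m‖ ≤ 1)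
    (hη : ∀ m t : ℤ, -(2 * S) ≤ m → m ≤ S → 0 ≤ t → t < L → ‖W (m + q * t) - W m‖ ≤ η)
    (hV : V ≤ ‖∑ m ∈ Finset.Icc (-(S : ℤ)) S, W m * z m‖) :
    ∃ m : ℤ, L * V ≤ (3 * S + 1) *
      (B * ‖∑ t ∈ Finset.Ico (0 : ℤ) L, z (m + q * t)‖ + L * η) := by
  by_contra hcon
  push Not at hcon
  -- Shifts go to the right by at most S, so extending the range to -2S on the left keeps the whole
  -- support of W in view for every shift.
  set I := Finset.Icc (-(2 * S : ℤ)) S with hI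
  have hcard : (I.card : ℝ) = 3 * S + 1 := by
    have : I.card = 3 * S + 1 := by
      simp only [hI, Int.card_Icc]; omega
    rw [this]; push_cast; ring
  have hshift : ∀ t ∈ Finset.Ico (0 : ℤ) L, ∑ m ∈ I, W (m + q * t) * z (m + q * t) =
      ∑ m ∈ Finset.Icc (-(S : ℤ)) S, W m * z m := by
    intro t ht
    rw [Finset.mem_Ico] at ht
    have h0 : 0 ≤ (q : ℤ) * t := mul_nonneg (by positivity) ht.1
    have h1 : (q : ℤ) * t ≤ S := by
      have : (q : ℤ) * t ≤ q * L := mul_le_mul_of_nonneg_left ht.2.le (by positivity)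
      exact this.trans (by exact_mod_cast hqL)
    rw [← Finset.sum_image (s := I) (g := fun m => m + (q : ℤ) * t) (f := fun m => W m * z m)
      (by intro x _ y _ h; simpa using h)]
    symm
    refine Finset.sum_subset ?_ ?_
    · intro m hm
      rw [Finset.mem_Icc] at hm
      refine Finset.mem_image.2 ⟨m - q * t, ?_, by ring⟩
      rw [hI, Finset.mem_Icc]
      omega
    · intro m _ hm
      rw [Finset.mem_Icc, not_and_or] at hm
      have : W m = 0 := by
        by_contra hne
        have := abs_le.1 (hW m hne)
        omega
      rw [this, zero_mul]
  have e : (L : ℂ) * ∑ m ∈ Finset.Icc (-(S : ℤ)) S, W m * z m =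
      ∑ m ∈ I, ∑ t ∈ Finset.Ico (0 : ℤ) L, W (m + q * t) * z (m + q * t) := by
    rw [Finset.sum_comm, Finset.sum_congr rfl hshift, Finset.sum_const, Int.card_Ico,
      nsmul_eq_mul]
    simp
  have hterm : ∀ m ∈ I, ‖∑ t ∈ Finset.Ico (0 : ℤ) L, W (m + q * t) * z (m + q * t)‖ ≤
      B * ‖∑ t ∈ Finset.Ico (0 : ℤ) L, z (m + q * t)‖ + L * η := by
    intro m hm
    rw [hI, Finset.mem_Icc] at hm
    have e1 : ∑ t ∈ Finset.Ico (0 : ℤ) L, W (m + q * t) * z (m + q * t) =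
        W m * ∑ t ∈ Finset.Ico (0 : ℤ) L, z (m + q * t) +
        ∑ t ∈ Finset.Ico (0 : ℤ) L, (W (m + q * t) - W m) * z (m + q * t) := by
      rw [Finset.mul_sum, ← Finset.sum_add_distrib]
      exact Finset.sum_congr rfl fun t _ => by ring
    rw [e1]
    refine (norm_add_le _ _).trans (add_le_add ?_ ?_)
    · rw [norm_mul]
      exact mul_le_mul_of_nonneg_right (hB m) (norm_nonneg _)
    · refine (norm_sum_le_of_le _ (f := _) (n := fun _ => η) ?_).trans ?_
      · intro t ht
        rw [Finset.mem_Ico] at ht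
        rw [norm_mul]
        calc _ ≤ ‖W (m + q * t) - W m‖ * 1 := by gcongr; exact hz _
          _ ≤ η := by rw [mul_one]; exact hη m t hm.1 hm.2 ht.1 ht.2
      · rw [Finset.sum_const, Int.card_Ico, nsmul_eq_mul]
        simp
  have h1 : L * V ≤ ∑ m ∈ I, (B * ‖∑ t ∈ Finset.Ico (0 : ℤ) L, z (m + q * t)‖ + L * η) := by
    calc L * V ≤ L * ‖∑ m ∈ Finset.Icc (-(S : ℤ)) S, W m * z m‖ := by gcongr
      _ = ‖(L : ℂ) * ∑ m ∈ Finset.Icc (-(S : ℤ)) S, W m * z m‖ := by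
        rw [norm_mul, Complex.norm_natCast]
      _ ≤ _ := by
        rw [e]
        exact norm_sum_le_of_le _ hterm
  have h2 : (3 * S + 1) * (∑ m ∈ I, (B * ‖∑ t ∈ Finset.Ico (0 : ℤ) L, z (m + q * t)‖ + L * η)) <
      (3 * S + 1) * (L * V) := by
    rw [Finset.mul_sum]
    calc _ < ∑ m ∈ I, (L : ℝ) * V :=
          Finset.sum_lt_sum_of_nonempty ⟨0, by rw [hI, Finset.mem_Icc]; omega⟩ fun m _ => hcon m
      _ = _ := by rw [Finset.sum_const, nsmul_eq_mul, hcard]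
  have h3 : (0 : ℝ) < 3 * S + 1 := by positivity
  have := lt_of_mul_lt_mul_left h2 h3.le
  linarith

/-- The quantitative form of `exists_large_progression` in which all losses are powers
of `Q`. -/
theorem exists_large_progression_pow {W z : ℤ → ℂ} {Q N q E L : ℕ} (hQ : 2 ≤ Q)
    (hL : L = N / Q ^ (E + 5)) (hN : Q ^ (E + 5) ≤ N) (hqL : q * L ≤ N)
    (hW : ∀ m, W m ≠ 0 → |m| ≤ Q * N) (hB : ∀ m, ‖W m‖ ≤ Q) (hz : ∀ m, ‖z m‖ ≤ 1)
    (hη : ∀ m t : ℤ, -(2 * (Q * N)) ≤ m → m ≤ Q * N → 0 ≤ t → t < L →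
      ‖W (m + q * t) - W m‖ ≤ (Q : ℝ) ^ E * L / N)
    (hV : (N : ℝ) ≤ Q * ‖∑ m ∈ Finset.Icc (-(Q * N : ℤ)) (Q * N), W m * z m‖) :
    ∃ m : ℤ, (L : ℝ) ≤ (Q : ℝ) ^ 6 * ‖∑ t ∈ Finset.Ico (0 : ℤ) L, z (m + q * t)‖ := by
  have hQ' : (2 : ℝ) ≤ Q := by exact_mod_cast hQ
  have hNpos : 0 < N := lt_of_lt_of_le (by positivity) hN
  have hNpos' : (1 : ℝ) ≤ N := by exact_mod_cast hNpos
  have hQpos : (0 : ℝ) < Q := by linarith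
  obtain ⟨m, hm⟩ := exists_large_progression (W := W) (z := z) (S := Q * N) (q := q) (L := L)
    (B := Q) (η := (Q : ℝ) ^ E * L / N) (V := N / Q)
    (hqL.trans (Nat.le_mul_of_pos_left _ (by omega))) (by push_cast; exact hW) hB hz
    (by push_cast; exact hη) (by rw [div_le_iff₀ hQpos, mul_comm]; push_cast; exact hV)
  refine ⟨m, ?_⟩
  set X := ‖∑ t ∈ Finset.Ico (0 : ℤ) L, z (m + q * t)‖
  have hX : 0 ≤ X := norm_nonneg _
  have hL0 : (0 : ℝ) ≤ L := Nat.cast_nonneg _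
  have hLN : (L : ℝ) * (Q : ℝ) ^ (E + 5) ≤ N := by
    have : L * Q ^ (E + 5) ≤ N := hL ▸ Nat.div_mul_le_self _ _
    exact_mod_cast this
  have h8 : (8 : ℝ) ≤ (Q : ℝ) ^ 3 := by
    calc (8 : ℝ) = 2 ^ 3 := by norm_num
      _ ≤ _ := by gcongr
  push_cast at hm
  have hη0 : 0 ≤ (Q : ℝ) ^ E * L / N := by positivity
  have h1 : L * (N / Q) ≤ 4 * (Q * N) * (Q * X + L * ((Q : ℝ) ^ E * L / N)) := by
    refine hm.trans (mul_le_mul_of_nonneg_right ?_ (by positivity))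
    nlinarith
  have h2 : (L : ℝ) * N ≤ 4 * Q ^ 3 * N * X + 4 * L * (L * Q ^ (E + 2)) := by
    calc (L : ℝ) * N = L * (N / Q) * Q := by field_simp
      _ ≤ 4 * (Q * N) * (Q * X + L * ((Q : ℝ) ^ E * L / N)) * Q := by gcongr
      _ = _ := by field_simp; ring
  -- This is what L = N / Q^{E+5} is for: the error from freezing the weight is at most half of the
  -- main term.
  have h3 : 8 * (L * (Q : ℝ) ^ (E + 2)) ≤ N := by
    calc 8 * (L * (Q : ℝ) ^ (E + 2)) ≤ (Q : ℝ) ^ 3 * (L * (Q : ℝ) ^ (E + 2)) := by gcongr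
      _ = L * (Q : ℝ) ^ (E + 5) := by ring
      _ ≤ N := hLN
  have h4 : (L : ℝ) * N ≤ 8 * Q ^ 3 * X * N := by
    have := mul_le_mul_of_nonneg_left h3 hL0
    nlinarith
  have h5 : (L : ℝ) ≤ 8 * Q ^ 3 * X := le_of_mul_le_mul_right h4 (by linarith)
  calc (L : ℝ) ≤ 8 * Q ^ 3 * X := h5
    _ ≤ (Q : ℝ) ^ 3 * Q ^ 3 * X := by gcongr
    _ = (Q : ℝ) ^ 6 * X := by ring

/-- Returns an approximation found at the shorter scale L to scale N. The extra 1 in E + 1 pays for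
the floor. -/
theorem div_pow_le_of_floor {Q N E L C k : ℕ} (hQ : 2 ≤ Q) (hL : L = N / Q ^ E)
    (hN : Q ^ E ≤ N) : (Q : ℝ) ^ C / (L : ℝ) ^ k ≤ (Q : ℝ) ^ (C + (E + 1) * k) / (N : ℝ) ^ k := by
  have hpos : 0 < Q ^ E := by positivity
  have hL1 : 1 ≤ L := hL ▸ (Nat.one_le_div_iff hpos).2 hN
  have hNpos : 0 < N := lt_of_lt_of_le hpos hN
  have h1 : N ≤ L * Q ^ (E + 1) := by
    have h2 : N < L * Q ^ E + Q ^ E := hL ▸ Nat.lt_div_mul_add hpos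
    rw [pow_succ]
    nlinarith
  have h1' : (N : ℝ) ≤ L * (Q : ℝ) ^ (E + 1) := by exact_mod_cast h1
  have hL1' : (0 : ℝ) < L := by exact_mod_cast hL1
  have hNpos' : (0 : ℝ) < N := by exact_mod_cast hNpos
  rw [div_le_div_iff₀ (by positivity) (by positivity)]
  calc (Q : ℝ) ^ C * (N : ℝ) ^ k ≤ (Q : ℝ) ^ C * (L * (Q : ℝ) ^ (E + 1)) ^ k := by gcongr
    _ = _ := by rw [mul_pow, ← pow_mul, pow_add]; ring

/-! ### Inverse theorem for the `TT*` kernel -/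

/-- `w` is a weight at scale `N`, with support, size and Lipschitz constant controlled
by `Q`. -/
structure IsScaleWeight (Q N : ℕ) (w : ℤ → ℝ) : Prop where
  support : ∀ m, w m ≠ 0 → |m| ≤ Q * N
  bound : ∀ m, |w m| ≤ Q
  lipschitz : ∀ m m', |w m - w m'| ≤ Q * |(m : ℝ) - m'| / N

/-- Since qt divides (m+qt)^{k+1} - m^{k+1}, the rational part b/q of α changes the phase by an
integer. Only the small error qα - b is felt. -/
theorem norm_charE_pow_sub_le {q k : ℕ} {α κ M : ℝ} {m t : ℤ} {b : ℤ} (hq : 1 ≤ q)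
    (hb : |q * α - b| ≤ κ) (hm : |(m : ℝ)| ≤ M) (hmt : |(m : ℝ) + q * t| ≤ M) :
    ‖charE (α * ((m + q * t : ℤ) : ℝ) ^ (k + 1)) - charE (α * (m : ℝ) ^ (k + 1))‖ ≤
      2 * Real.pi * (κ * (|(q : ℝ) * t| * (k + 1) * M ^ k)) := by
  obtain ⟨G, hG⟩ : (q : ℤ) * t ∣ (m + q * t) ^ (k + 1) - m ^ (k + 1) := by
    have := sub_dvd_pow_sub_pow (m + q * t) m (k + 1)
    rwa [add_sub_cancel_left] at this
  have hG' : ((m : ℝ) + q * t) ^ (k + 1) - (m : ℝ) ^ (k + 1) = q * t * G := by exact_mod_cast hG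
  have hq' : (1 : ℝ) ≤ q := by exact_mod_cast hq
  have hκ : 0 ≤ κ := (abs_nonneg _).trans hb
  have hM : 0 ≤ M := (abs_nonneg _).trans hm
  have e : α * ((m + q * t : ℤ) : ℝ) ^ (k + 1) =
      ((q * α - b) * (t * G) + ((b * (t * G) : ℤ) : ℝ)) + α * (m : ℝ) ^ (k + 1) := by
    push_cast
    linear_combination α * hG'
  rw [e, charE_add, charE_add, charE_intCast, mul_one]
  have e2 : charE ((q * α - b) * (t * G)) * charE (α * (m : ℝ) ^ (k + 1)) -
      charE (α * (m : ℝ) ^ (k + 1)) =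
      (charE ((q * α - b) * (t * G)) - 1) * charE (α * (m : ℝ) ^ (k + 1)) := by ring
  rw [e2, norm_mul, norm_charE, mul_one]
  refine (norm_charE_sub_one_le _).trans ?_
  rw [abs_mul]
  gcongr
  have h1 : |(t : ℝ) * G| ≤ |(q : ℝ) * t * G| := by
    rw [mul_assoc, abs_mul (q : ℝ), Nat.abs_cast]
    nlinarith [abs_nonneg ((t : ℝ) * G)]
  refine h1.trans ?_
  rw [← hG']
  refine (abs_pow_sub_pow_le _ _ _).trans ?_
  rw [add_sub_cancel_left]
  rw [Nat.add_sub_cancel]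
  push_cast
  gcongr
  exact max_le hmt hm

/-- If the kernel sum at displacement `n` is large, then `μ n` is close to a rational with small
denominator, irrespective of the other frequency `l`. -/
theorem kernel_inverse (k : ℕ) : ∃ C : ℕ, ∀ Q N : ℕ, 2 ≤ Q → Q ^ C ≤ N → ∀ w : ℤ → ℝ,
    IsScaleWeight Q N w → ∀ (μ l : ℝ) (n : ℤ),
      (N : ℝ) ≤ Q * ‖∑ m ∈ Finset.Icc (-(Q * N : ℤ)) (Q * N),
        (w m : ℂ) * charE (μ * ((m : ℝ) - n) ^ (k + 2) - l * (m : ℝ) ^ (k + 2))‖ →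
      ∃ q : ℕ, 1 ≤ q ∧ q ≤ Q ^ C ∧ NearInt ((Q : ℝ) ^ C / (N : ℝ) ^ (k + 1)) (q * (μ * n)) := by
  obtain ⟨C₁, hC₁⟩ := weyl_inverse (k + 1)
  obtain ⟨C₀, hC₀⟩ := weyl_inverse k
  -- E₁ is the error exponent for q₁α after returning from scale N/Q⁶. E₂ bounds the variation of
  -- the weight once the leading term is folded into it.
  set E₁ := 6 * C₁ + 7 * (k + 2) with hE₁
  set E₂ := E₁ + 6 * C₁ + 3 * (k + 2) + 6 with hE₂
  set C := 6 * C₀ + 6 * C₁ + 6 * C₁ * (k + 1) + (k + 2) + (E₂ + 5 + 1) * (k + 1) + E₂ + 12 with hC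
  refine ⟨C, fun Q N hQ hN w hw μ l n hs => ?_⟩
  have hQ1 : 1 ≤ Q := by omega
  have hQ' : (2 : ℝ) ≤ Q := by exact_mod_cast hQ
  have hQ1' : (1 : ℝ) ≤ Q := by linarith
  have hN1 : 1 ≤ N := le_trans (Nat.one_le_pow _ _ (by omega)) hN
  have hN1' : (1 : ℝ) ≤ N := by exact_mod_cast hN1
  have hNpos : (0 : ℝ) < N := by linarith
  have hpw : ∀ {i : ℕ}, i ≤ C → Q ^ i ≤ N := fun hi => (Nat.pow_le_pow_right hQ1 hi).trans hN
  set α := μ - l with hα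
  -- The phase is αm^{k+2} + R(m). The frequency l enters only through α, and R has degree k + 1
  -- with top coefficient -(k+2)μn.
  set R : ℤ → ℝ := fun m => μ * (((m + -n : ℤ) : ℝ) ^ (k + 2) - (m : ℝ) ^ (k + 2)) with hR
  have hRpoly : PolyPhase (k + 1) (μ * (((k + 1 : ℕ) + 1) * 1 * (-n : ℤ))) R :=
    PolyPhase.const_mul μ (polyPhase_pow (k + 2) (-n))
  set φ : ℤ → ℝ := fun m => α * (m : ℝ) ^ (k + 2) + R m with hφ
  have hφpoly : PolyPhase (k + 2) (α * 1 + 0) φ :=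
    ((polyPhase_pow (k + 2)).const_mul α).add hRpoly.succ
  have hφe : ∀ m : ℤ, μ * ((m : ℝ) - n) ^ (k + 2) - l * (m : ℝ) ^ (k + 2) = φ m := by
    intro m
    simp only [hφ, hR, hα]
    push_cast
    ring
  simp only [hφe] at hs
  -- the leading coefficient
  obtain ⟨q₁, hq₁, hq₁', b, hb⟩ : ∃ q : ℕ, 1 ≤ q ∧ q ≤ Q ^ (6 * C₁) ∧
      NearInt ((Q : ℝ) ^ E₁ / (N : ℝ) ^ (k + 2)) (q * α) := by
    set L := N / Q ^ (1 + 5) with hL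
    have hLle : Q ^ (6 * C₁) ≤ L := by
      rw [hL, Nat.le_div_iff_mul_le (by positivity), ← pow_add]
      exact hpw (by omega)
    obtain ⟨m, hm⟩ := exists_large_progression_pow (W := fun m => (w m : ℂ))
      (z := fun m => charE (φ m)) (q := 1) (E := 1) hQ hL (hpw (by omega))
      (by rw [one_mul]; exact Nat.div_le_self _ _)
      (fun m hm => hw.support m (by simpa using hm))
      (fun m => by simpa using hw.bound m) (fun m => (norm_charE _).le)
      (fun m t _ _ ht ht' => by
        rw [← Complex.ofReal_sub, Complex.norm_real, Real.norm_eq_abs]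
        refine (hw.lipschitz _ _).trans ?_
        have htL : (t : ℝ) ≤ L := by exact_mod_cast ht'.le
        have ht0 : (0 : ℝ) ≤ t := by exact_mod_cast ht
        push_cast
        rw [one_mul, add_sub_cancel_left, abs_of_nonneg ht0, pow_one]
        gcongr) hs
    obtain ⟨q, hq1, hq2, hq3⟩ := hC₁ (Q ^ 6) L (by nlinarith [Nat.pow_le_pow_left hQ 6])
      (by rw [← pow_mul]; exact hLle) _ _ (hφpoly.comp_affine m 1) 0 L (by simp)
      (by push_cast at hm ⊢; exact hm)
    refine ⟨q, hq1, by rw [pow_mul]; exact hq2, ?_⟩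
    have := div_pow_le_of_floor (C := 6 * C₁) (k := k + 2) hQ hL (hpw (by omega))
    refine NearInt.mono (κ := (Q : ℝ) ^ (6 * C₁) / (L : ℝ) ^ (k + 2)) ?_ this
    rw [pow_mul]
    push_cast at hq3
    simpa using hq3
  -- the next coefficient
  set L := N / Q ^ (E₂ + 5) with hL
  have hLle : Q ^ (6 * C₀) ≤ L := by
    rw [hL, Nat.le_div_iff_mul_le (by positivity), ← pow_add]
    exact hpw (by omega)
  have hqL : q₁ * L ≤ N := by
    calc q₁ * L ≤ Q ^ (E₂ + 5) * L :=
          Nat.mul_le_mul_right _ (hq₁'.trans (Nat.pow_le_pow_right hQ1 (by omega)))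
      _ ≤ N := Nat.mul_div_le _ _
  have hq₁R : (q₁ : ℝ) ≤ (Q : ℝ) ^ (6 * C₁) := by exact_mod_cast hq₁'
  have hqLR : (q₁ : ℝ) * L ≤ N := by exact_mod_cast hqL
  -- The factor e(αm^{k+2}) now belongs to the weight: along difference q₁ it varies slowly, by the
  -- approximation of q₁α. Only R is left to be summed.
  obtain ⟨m, hm⟩ := exists_large_progression_pow
    (W := fun m => (w m : ℂ) * charE (α * (m : ℝ) ^ (k + 2)))
    (z := fun m => charE (R m)) (q := q₁) (E := E₂) hQ hL (hpw (by omega)) hqL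
    (fun m hm => hw.support m (by simpa using left_ne_zero_of_mul hm))
    (fun m => by rw [norm_mul, norm_charE, mul_one]; simpa using hw.bound m)
    (fun m => (norm_charE _).le)
    (fun m t hm1 hm2 ht ht' => by
      have htL : (t : ℝ) ≤ L := by exact_mod_cast ht'.le
      have ht0 : (0 : ℝ) ≤ t := by exact_mod_cast ht
      have hqt0 : (0 : ℝ) ≤ q₁ * t := by positivity
      have hqtL : (q₁ : ℝ) * t ≤ (Q : ℝ) ^ (6 * C₁) * L := by gcongr
      have hqtN : (q₁ : ℝ) * t ≤ N := (mul_le_mul_of_nonneg_left htL (by positivity)).trans hqLR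
      have hm1' : -(2 * (Q * N : ℝ)) ≤ m := by exact_mod_cast hm1
      have hm2' : (m : ℝ) ≤ Q * N := by exact_mod_cast hm2
      have hQN : (0 : ℝ) < Q * N := by positivity
      have hNQN : (N : ℝ) ≤ Q * N := by nlinarith
      have hph := norm_charE_pow_sub_le (k := k + 1) (M := 2 * (Q * N)) (m := m) (t := t) hq₁ hb
        (by rw [abs_le]; constructor <;> linarith) (by rw [abs_le]; constructor <;> linarith)
      have hwl := hw.lipschitz (m + q₁ * t) m
      push_cast at hwl
      rw [add_sub_cancel_left, abs_of_nonneg hqt0] at hwl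
      have hsplit : (w (m + q₁ * t) : ℂ) * charE (α * ((m + q₁ * t : ℤ) : ℝ) ^ (k + 2)) -
          w m * charE (α * (m : ℝ) ^ (k + 2)) =
          ((w (m + q₁ * t) - w m : ℝ) : ℂ) * charE (α * ((m + q₁ * t : ℤ) : ℝ) ^ (k + 2)) +
          w m * (charE (α * ((m + q₁ * t : ℤ) : ℝ) ^ (k + 2)) - charE (α * (m : ℝ) ^ (k + 2))) := by
        push_cast; ring
      rw [hsplit]
      refine (norm_add_le _ _).trans ?_
      rw [norm_mul, norm_mul, norm_charE, mul_one, Complex.norm_real, Complex.norm_real,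
        Real.norm_eq_abs, Real.norm_eq_abs]
      have h1 : |w (m + q₁ * t) - w m| ≤ (Q : ℝ) ^ (E₂ - 1) * L / N := by
        refine hwl.trans ?_
        gcongr ?_ / _
        calc (Q : ℝ) * (q₁ * t) ≤ Q * ((Q : ℝ) ^ (6 * C₁) * L) := by gcongr
          _ = (Q : ℝ) ^ (6 * C₁ + 1) * L := by ring
          _ ≤ (Q : ℝ) ^ (E₂ - 1) * L := by
            gcongr ?_ * _
            exact pow_le_pow_right₀ hQ1' (by omega)
      have h8 : 2 * Real.pi ≤ (Q : ℝ) ^ 3 := by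
        calc 2 * Real.pi ≤ 2 ^ 3 := by linarith [Real.pi_le_four]
          _ ≤ _ := by gcongr
      have hkQ : (((k + 1 : ℕ) : ℝ) + 1) ≤ (Q : ℝ) ^ (k + 2) := by
        have : k + 2 ≤ Q ^ (k + 2) :=
          (Nat.lt_two_pow_self (n := k + 2)).le.trans (Nat.pow_le_pow_left hQ _)
        have : ((k + 2 : ℕ) : ℝ) ≤ (Q : ℝ) ^ (k + 2) := by exact_mod_cast this
        refine le_trans (le_of_eq ?_) this
        push_cast; ring
      have h2 : |w m| * ‖charE (α * ((m + q₁ * t : ℤ) : ℝ) ^ (k + 2)) -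
          charE (α * (m : ℝ) ^ (k + 2))‖ ≤ (Q : ℝ) ^ (E₂ - 1) * L / N := by
        calc _ ≤ (Q : ℝ) * (2 * Real.pi * ((Q : ℝ) ^ E₁ / (N : ℝ) ^ (k + 2) *
              (|(q₁ : ℝ) * t| * ((k + 1 : ℕ) + 1) * (2 * (Q * N)) ^ (k + 1)))) :=
              mul_le_mul (hw.bound m) hph (norm_nonneg _) (by positivity)
          _ ≤ (Q : ℝ) * ((Q : ℝ) ^ 3 * ((Q : ℝ) ^ E₁ / (N : ℝ) ^ (k + 2) *
              (((Q : ℝ) ^ (6 * C₁) * L) * (Q : ℝ) ^ (k + 2) * (Q * (Q * N)) ^ (k + 1)))) := by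
              rw [abs_of_nonneg hqt0]
              gcongr
          _ = (Q : ℝ) ^ (4 + E₁ + 6 * C₁ + (k + 2) + 2 * (k + 1)) * L / N := by
              field_simp
              ring
          _ ≤ (Q : ℝ) ^ (E₂ - 1) * L / N := by
            gcongr ?_ * _ / _
            exact pow_le_pow_right₀ hQ1' (by omega)
      calc _ ≤ (Q : ℝ) ^ (E₂ - 1) * L / N + (Q : ℝ) ^ (E₂ - 1) * L / N := add_le_add h1 h2
        _ = 2 * (Q : ℝ) ^ (E₂ - 1) * L / N := by ring
        _ ≤ Q * (Q : ℝ) ^ (E₂ - 1) * L / N := by gcongr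
        _ = (Q : ℝ) ^ E₂ * L / N := by
          rw [← pow_succ']
          congr 3)
    (by
      refine hs.trans_eq ?_
      congr 2
      refine Finset.sum_congr rfl fun m _ => ?_
      rw [mul_assoc, ← charE_add])
  obtain ⟨q, hq1, hq2, c, hc⟩ := hC₀ (Q ^ 6) L (by nlinarith [Nat.pow_le_pow_left hQ 6])
    (by rw [← pow_mul]; exact hLle) _ _ (hRpoly.comp_affine m q₁) 0 L (by simp)
    (by push_cast at hm ⊢; exact hm)
  -- Along the progression R has top coefficient -q₁^{k+1}(k+2)μn, so these factors move into the
  -- denominator.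
  refine ⟨q * (q₁ ^ (k + 1) * (k + 2)), Nat.mul_pos hq1 (Nat.mul_pos (by positivity) (by omega)),
    ?_, ?_⟩
  · have hk2 : k + 2 ≤ Q ^ (k + 2) :=
      (Nat.lt_two_pow_self (n := k + 2)).le.trans (Nat.pow_le_pow_left hQ _)
    calc q * (q₁ ^ (k + 1) * (k + 2)) ≤
          (Q ^ 6) ^ C₀ * ((Q ^ (6 * C₁)) ^ (k + 1) * Q ^ (k + 2)) := by gcongr
      _ = Q ^ (6 * C₀ + (6 * C₁ * (k + 1) + (k + 2))) := by
        rw [← pow_mul, ← pow_mul, ← pow_add, ← pow_add]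
      _ ≤ Q ^ C := Nat.pow_le_pow_right hQ1 (by omega)
  · refine ⟨-c, ?_⟩
    have h1 := div_pow_le_of_floor (C := 6 * C₀) (k := k + 1) hQ hL (hpw (by omega))
    have e : ((q * (q₁ ^ (k + 1) * (k + 2)) : ℕ) : ℝ) * (μ * n) - ((-c : ℤ) : ℝ) =
        -(q * (((q₁ : ℤ) : ℝ) ^ (k + 1) * (μ * (((k + 1 : ℕ) + 1) * 1 * ((-n : ℤ) : ℝ)))) - c) := by
      push_cast; ring
    rw [e, abs_neg]
    refine hc.trans ?_
    push_cast
    rw [← pow_mul]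
    refine h1.trans ?_
    gcongr ?_ / _
    exact pow_le_pow_right₀ hQ1' (by omega)

/-- If `μ` is not close to a rational with small denominator, then the kernel sum is large for few
displacements `n`, even if the second frequency is allowed to depend on `n`. -/
theorem card_large_kernel_le (k : ℕ) : ∃ C : ℕ, ∀ Q N : ℕ, 2 ≤ Q → Q ^ C ≤ N → ∀ μ : ℝ,
    (∀ q : ℕ, 1 ≤ q → q ≤ Q ^ C → ¬ NearInt ((Q : ℝ) ^ C / (N : ℝ) ^ (k + 2)) (q * μ)) →
    ∀ (w : ℤ → ℤ → ℝ) (l : ℤ → ℝ), (∀ n, IsScaleWeight Q N (w n)) →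
      ((Finset.Icc (-(Q * N : ℤ)) (Q * N)).filter (fun n => (N : ℝ) ≤ Q *
        ‖∑ m ∈ Finset.Icc (-(Q * N : ℤ)) (Q * N), (w n m : ℂ) *
          charE (μ * ((m : ℝ) - n) ^ (k + 2) - l n * (m : ℝ) ^ (k + 2))‖)).card * Q ≤ N := by
  obtain ⟨C, hC⟩ := kernel_inverse k
  refine ⟨13 * (C + 3) + C, fun Q N hQ hN μ hμ w l hw => ?_⟩
  by_contra hcon
  push Not at hcon
  have hQ1 : 1 ≤ Q := by omega
  have hQ1' : (1 : ℝ) ≤ Q := by exact_mod_cast hQ1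
  have hN1 : 1 ≤ N := le_trans (Nat.one_le_pow _ _ (by omega)) hN
  have hN1' : (1 : ℝ) ≤ N := by exact_mod_cast hN1
  have hpw : ∀ {i : ℕ}, i ≤ 13 * (C + 3) + C → Q ^ i ≤ N := fun hi =>
    (Nat.pow_le_pow_right hQ1 hi).trans hN
  set H := (Finset.Icc (-(Q * N : ℤ)) (Q * N)).filter (fun n => (N : ℝ) ≤ Q *
        ‖∑ m ∈ Finset.Icc (-(Q * N : ℤ)) (Q * N), (w n m : ℂ) *
          charE (μ * ((m : ℝ) - n) ^ (k + 2) - l n * (m : ℝ) ^ (k + 2))‖)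
  -- Recurrence over the bad displacements n gains the last factor N, contradicting the hypothesis
  -- on μ. The window has length QN, so density 1/Q relative to N becomes 1/Q².
  obtain ⟨q, hq1, hq2, hq3⟩ := exists_nearInt_of_many_mul (Q := Q ^ (C + 3)) (N := Q * N)
    (κ := (Q : ℝ) ^ C / (N : ℝ) ^ (k + 1)) (θ := μ) (H := H)
    (hQ.trans (by
      calc Q = Q ^ 1 := (pow_one _).symm
        _ ≤ Q ^ (C + 3) := Nat.pow_le_pow_right hQ1 (by omega)))
    (by
      rw [← pow_mul]
      exact (hpw (by omega)).trans (Nat.le_mul_of_pos_left _ hQ1))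
    (by
      push_cast
      rw [div_mul_eq_mul_div, div_le_one (by positivity), ← pow_mul, ← pow_add]
      calc (Q : ℝ) ^ (C + (C + 3) * 10) ≤ N := by exact_mod_cast hpw (by omega)
        _ = (N : ℝ) ^ 1 := (pow_one _).symm
        _ ≤ (N : ℝ) ^ (k + 1) := pow_le_pow_right₀ hN1' (by omega))
    (by push_cast; exact Finset.filter_subset _ _)
    (by
      calc Q * N ≤ Q * (H.card * Q) := Nat.mul_le_mul_left _ hcon.le
        _ = H.card * Q ^ 2 := by ring
        _ ≤ H.card * Q ^ (C + 3) :=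
          Nat.mul_le_mul_left _ (Nat.pow_le_pow_right hQ1 (by omega)))
    (by
      intro n hn
      obtain ⟨q, h1, h2, h3⟩ := hC Q N hQ (hpw (by omega)) (w n) (hw n) μ (l n) n
        (Finset.mem_filter.1 hn).2
      exact ⟨q, h1, h2.trans (Nat.pow_le_pow_right hQ1 (by omega)), h3⟩)
  refine hμ q hq1 (hq2.trans ?_) (hq3.mono ?_)
  · rw [← pow_mul]
    exact Nat.pow_le_pow_right hQ1 (by omega)
  · push_cast
    rw [← pow_mul, mul_div_assoc', ← pow_add, div_div]
    have h1 : (Q : ℝ) ^ ((C + 3) * 13 + C) = (Q : ℝ) ^ (13 * (C + 3) + C) := by ring_nf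
    rw [h1, pow_succ (N : ℝ) (k + 1)]
    gcongr
    nlinarith

/-! ### `TT*` and interpolation on a window -/

/-- The `TT*` method with Schur's test, for finite matrices. -/
theorem sum_norm_sq_le_of_schur {ι : Type*} {J Y : Finset ι} {a : ι → ι → ℂ} {ε : ℝ} (hε : 0 ≤ ε)
    (hK : ∀ x ∈ J, ∑ x' ∈ J, ‖∑ y ∈ Y, (starRingEnd ℂ) (a x y) * a x' y‖ ≤ ε) (f : ι → ℂ) :
    ∑ x ∈ J, ‖∑ y ∈ Y, a x y * f y‖ ^ 2 ≤ ε * ∑ y ∈ Y, ‖f y‖ ^ 2 := by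
  set g : ι → ℂ := fun x => ∑ y ∈ Y, a x y * f y with hg
  set G : ι → ℂ := fun y => ∑ x ∈ J, (starRingEnd ℂ) (g x) * a x y with hG
  set K : ι → ι → ℂ := fun x x' => ∑ y ∈ Y, (starRingEnd ℂ) (a x y) * a x' y with hKdef
  set S : ℝ := ∑ x ∈ J, ‖g x‖ ^ 2 with hS
  set F : ℝ := ∑ y ∈ Y, ‖f y‖ ^ 2 with hF
  have hS0 : 0 ≤ S := Finset.sum_nonneg fun _ _ => by positivity
  have hF0 : 0 ≤ F := Finset.sum_nonneg fun _ _ => by positivity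
  have hSG : (S : ℂ) = ∑ y ∈ Y, G y * f y := by
    rw [hS]
    push_cast
    simp only [hG, Finset.sum_mul]
    rw [Finset.sum_comm]
    refine Finset.sum_congr rfl fun x _ => ?_
    rw [← Complex.conj_mul', hg, Finset.mul_sum]
    exact Finset.sum_congr rfl fun y _ => by ring
  -- The kernel is Hermitian, so bounding its rows also bounds its columns.
  have hsymm : ∀ x x', ‖K x x'‖ = ‖K x' x‖ := by
    intro x x'
    rw [← RCLike.norm_conj (K x x')]
    congr 1
    simp only [hKdef, map_sum, map_mul, Complex.conj_conj]
    exact Finset.sum_congr rfl fun y _ => by ring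
  have hGe : ((∑ y ∈ Y, ‖G y‖ ^ 2 : ℝ) : ℂ) =
      ∑ x ∈ J, ∑ x' ∈ J, g x * (starRingEnd ℂ) (g x') * K x x' := by
    push_cast
    have : ∀ y, (‖G y‖ : ℂ) ^ 2 = ∑ x ∈ J, ∑ x' ∈ J,
        g x * (starRingEnd ℂ) (g x') * ((starRingEnd ℂ) (a x y) * a x' y) := by
      intro y
      rw [← Complex.conj_mul', hG]
      simp only [map_sum, map_mul, Complex.conj_conj, Finset.sum_mul, Finset.mul_sum]
      rw [Finset.sum_comm]
      exact Finset.sum_congr rfl fun x _ => Finset.sum_congr rfl fun x' _ => by ring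
    simp only [this, hKdef, Finset.mul_sum]
    rw [Finset.sum_comm]
    refine Finset.sum_congr rfl fun x _ => ?_
    rw [Finset.sum_comm]
  have hGle : ∑ y ∈ Y, ‖G y‖ ^ 2 ≤ ε * S := by
    have h1 : ∑ y ∈ Y, ‖G y‖ ^ 2 ≤ ∑ x ∈ J, ∑ x' ∈ J, ‖g x‖ * ‖g x'‖ * ‖K x x'‖ := by
      calc ∑ y ∈ Y, ‖G y‖ ^ 2 ≤ ‖((∑ y ∈ Y, ‖G y‖ ^ 2 : ℝ) : ℂ)‖ := by
            rw [Complex.norm_real]; exact Real.le_norm_self _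
        _ ≤ _ := by
            rw [hGe]
            refine norm_sum_le_of_le _ fun x _ => norm_sum_le_of_le _ fun x' _ => ?_
            rw [norm_mul, norm_mul, RCLike.norm_conj]
    have h2 : ∑ x ∈ J, ∑ x' ∈ J, ‖g x‖ * ‖g x'‖ * ‖K x x'‖ ≤
        ∑ x ∈ J, ∑ x' ∈ J, (‖g x‖ ^ 2 * ‖K x x'‖ / 2 + ‖g x'‖ ^ 2 * ‖K x x'‖ / 2) := by
      refine Finset.sum_le_sum fun x _ => Finset.sum_le_sum fun x' _ => ?_
      nlinarith [mul_nonneg (sq_nonneg (‖g x‖ - ‖g x'‖)) (norm_nonneg (K x x'))]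
    have h3 : ∑ x ∈ J, ∑ x' ∈ J, ‖g x‖ ^ 2 * ‖K x x'‖ / 2 ≤ ε * S / 2 := by
      rw [hS, Finset.mul_sum, Finset.sum_div]
      refine Finset.sum_le_sum fun x hx => ?_
      rw [← Finset.sum_div, ← Finset.mul_sum]
      have := mul_le_mul_of_nonneg_left (hK x hx) (sq_nonneg ‖g x‖)
      simp only [hKdef]
      linarith
    have h4 : ∑ x ∈ J, ∑ x' ∈ J, ‖g x'‖ ^ 2 * ‖K x x'‖ / 2 ≤ ε * S / 2 := by
      rw [Finset.sum_comm]
      simpa only [hsymm] using h3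
    refine h1.trans (h2.trans ?_)
    simp only [Finset.sum_add_distrib]
    linarith
  have hSq : S ^ 2 ≤ (ε * F) * S := by
    have h1 : S ≤ ∑ y ∈ Y, ‖G y‖ * ‖f y‖ := by
      calc S ≤ ‖(S : ℂ)‖ := by rw [Complex.norm_real]; exact Real.le_norm_self _
        _ ≤ _ := by
            rw [hSG]
            exact norm_sum_le_of_le _ fun y _ => (norm_mul _ _).le
    calc S ^ 2 ≤ (∑ y ∈ Y, ‖G y‖ * ‖f y‖) ^ 2 := by gcongr
      _ ≤ (∑ y ∈ Y, ‖G y‖ ^ 2) * F := Finset.sum_mul_sq_le_sq_mul_sq _ _ _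
      _ ≤ (ε * S) * F := by gcongr
      _ = (ε * F) * S := by ring
  rcases hS0.eq_or_lt with h0 | h0
  · rw [← h0]
    positivity
  · rw [sq] at hSq
    exact le_of_mul_le_mul_right hSq h0

/-- A finite matrix with `O(N)` columns and entries `O(1/N)`, acting on windows of length `N`. -/
structure IsWindowKernel (D N : ℝ) (J Y : Finset ℤ) (a : ℤ → ℤ → ℂ) : Prop where
  card_left : (J.card : ℝ) ≤ N
  card_right : (Y.card : ℝ) ≤ D * N
  bound : ∀ x ∈ J, ∀ y ∈ Y, ‖a x y‖ ≤ D / N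

theorem IsWindowKernel.norm_sum_le {D N : ℝ} {J Y : Finset ℤ} {a : ℤ → ℤ → ℂ}
    (ha : IsWindowKernel D N J Y a) (f : ℤ → ℂ) {x : ℤ} (hx : x ∈ J) :
    ‖∑ y ∈ Y, a x y * f y‖ ≤ D / N * ∑ y ∈ Y, ‖f y‖ := by
  rw [Finset.mul_sum]
  refine norm_sum_le_of_le _ fun y hy => ?_
  rw [norm_mul]
  exact mul_le_mul_of_nonneg_right (ha.bound x hx y hy) (norm_nonneg _)

theorem rpow_sum_norm_le {Y : Finset ℤ} {Z r : ℝ} (hZ : (Y.card : ℝ) ≤ Z) (hr : 1 ≤ r)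
    {v : ℤ → ℝ} (hv : ∀ y, 0 ≤ v y) :
    (∑ y ∈ Y, v y) ^ r ≤ Z ^ (r - 1) * ∑ y ∈ Y, v y ^ r := by
  have := Real.rpow_sum_le_const_mul_sum_rpow Y v hr
  simp only [abs_of_nonneg (hv _)] at this
  refine this.trans ?_
  have h0 : 0 ≤ ∑ y ∈ Y, v y ^ r := Finset.sum_nonneg fun y _ => Real.rpow_nonneg (hv y) _
  gcongr

/-- Hölder with the trivial entry bound and no cancellation; this serves the finitely many small j.
-/
theorem IsWindowKernel.sum_rpow_le {D N p : ℝ} {J Y : Finset ℤ} {a : ℤ → ℤ → ℂ}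
    (ha : IsWindowKernel D N J Y a) (hD : 1 ≤ D) (hN : 0 < N) (hp : 1 < p) (f : ℤ → ℂ) :
    ∑ x ∈ J, ‖∑ y ∈ Y, a x y * f y‖ ^ p ≤ D ^ (2 * p - 1) * ∑ y ∈ Y, ‖f y‖ ^ p := by
  have hD0 : 0 < D := by linarith
  set P := ∑ y ∈ Y, ‖f y‖ ^ p
  have hP0 : 0 ≤ P := Finset.sum_nonneg fun y _ => by positivity
  have h1 := rpow_sum_norm_le ha.card_right hp.le (v := fun y => ‖f y‖) fun y => norm_nonneg _
  have hs0 : 0 ≤ ∑ y ∈ Y, ‖f y‖ := Finset.sum_nonneg fun y _ => norm_nonneg _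
  calc ∑ x ∈ J, ‖∑ y ∈ Y, a x y * f y‖ ^ p
      ≤ ∑ x ∈ J, (D / N) ^ p * ((D * N) ^ (p - 1) * P) := by
        refine Finset.sum_le_sum fun x hx => ?_
        calc _ ≤ (D / N * ∑ y ∈ Y, ‖f y‖) ^ p := by
              gcongr
              exact ha.norm_sum_le f hx
          _ = (D / N) ^ p * (∑ y ∈ Y, ‖f y‖) ^ p := Real.mul_rpow (by positivity) hs0
          _ ≤ _ := by gcongr
    _ ≤ N * ((D / N) ^ p * ((D * N) ^ (p - 1) * P)) := by
        rw [Finset.sum_const, nsmul_eq_mul]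
        gcongr
        exact ha.card_left
    _ = D ^ (2 * p - 1) * P := by
        rw [Real.div_rpow hD0.le hN.le, Real.mul_rpow hD0.le hN.le, Real.rpow_sub_one hN.ne',
          show 2 * p - 1 = p + (p - 1) by ring, Real.rpow_add hD0]
        have : N ^ p ≠ 0 := by positivity
        field_simp

/-- Of the p factors of |Tf|, p - 2 are bounded pointwise by the average of |f| and two by the ℓ²
estimate. Hölder on Y recombines them. -/
theorem IsWindowKernel.sum_rpow_le_of_two_le {D N p ε : ℝ} {J Y : Finset ℤ} {a : ℤ → ℤ → ℂ}
    (ha : IsWindowKernel D N J Y a) (hD : 1 ≤ D) (hN : 0 < N) (hp : 2 ≤ p) (hε : 0 ≤ ε)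
    (h2 : ∀ f : ℤ → ℂ, ∑ x ∈ J, ‖∑ y ∈ Y, a x y * f y‖ ^ 2 ≤ ε * ∑ y ∈ Y, ‖f y‖ ^ 2)
    (f : ℤ → ℂ) :
    ∑ x ∈ J, ‖∑ y ∈ Y, a x y * f y‖ ^ p ≤ D ^ (2 * (p - 2)) * ε * ∑ y ∈ Y, ‖f y‖ ^ p := by
  have hD0 : 0 < D := by linarith
  have hp0 : 0 < p := by linarith
  set P := ∑ y ∈ Y, ‖f y‖ ^ p with hP
  set s := ∑ y ∈ Y, ‖f y‖ with hs
  set T := ∑ y ∈ Y, ‖f y‖ ^ 2 with hT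
  set Z := D * N with hZ
  have hZ0 : 0 < Z := by positivity
  have hP0 : 0 ≤ P := Finset.sum_nonneg fun y _ => by positivity
  have hs0 : 0 ≤ s := Finset.sum_nonneg fun y _ => norm_nonneg _
  have hT0 : 0 ≤ T := Finset.sum_nonneg fun y _ => by positivity
  have h1 : s ^ p ≤ Z ^ (p - 1) * P :=
    rpow_sum_norm_le ha.card_right (by linarith) (v := fun y => ‖f y‖) fun y => norm_nonneg _
  have h3 : T ^ (p / 2) ≤ Z ^ (p / 2 - 1) * P := by
    have := rpow_sum_norm_le ha.card_right (r := p / 2) (by linarith)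
      (v := fun y => ‖f y‖ ^ 2) fun y => by positivity
    refine this.trans_eq ?_
    congr 1
    refine Finset.sum_congr rfl fun y _ => ?_
    rw [← Real.rpow_natCast, ← Real.rpow_mul (norm_nonneg _)]
    congr 1
    push_cast
    ring
  have h4 : s ^ (p - 2) * T ≤ Z ^ (p - 2) * P := by
    rw [← Real.rpow_le_rpow_iff (by positivity) (by positivity) hp0]
    calc (s ^ (p - 2) * T) ^ p = (s ^ p) ^ (p - 2) * (T ^ (p / 2)) ^ (2 : ℝ) := by
          rw [Real.mul_rpow (by positivity) hT0, ← Real.rpow_mul hs0, ← Real.rpow_mul hs0,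
            ← Real.rpow_mul hT0, mul_comm p (p - 2), div_mul_cancel₀ _ two_ne_zero]
      _ ≤ (Z ^ (p - 1) * P) ^ (p - 2) * (Z ^ (p / 2 - 1) * P) ^ (2 : ℝ) := by
          gcongr
      _ = (Z ^ (p - 2) * P) ^ p := by
          rw [Real.mul_rpow (by positivity) hP0, Real.mul_rpow (by positivity) hP0,
            Real.mul_rpow (by positivity) hP0, ← Real.rpow_mul hZ0.le, ← Real.rpow_mul hZ0.le,
            ← Real.rpow_mul hZ0.le]
          have e1 : Z ^ ((p - 1) * (p - 2)) * P ^ (p - 2) *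
              (Z ^ ((p / 2 - 1) * 2) * P ^ (2 : ℝ)) =
              (Z ^ ((p - 1) * (p - 2)) * Z ^ ((p / 2 - 1) * 2)) * (P ^ (p - 2) * P ^ (2 : ℝ)) := by
            ring
          rw [e1, ← Real.rpow_add hZ0, ← Real.rpow_add_of_nonneg hP0 (by linarith) (by norm_num)]
          congr 2 <;> ring
  calc ∑ x ∈ J, ‖∑ y ∈ Y, a x y * f y‖ ^ p
      ≤ ∑ x ∈ J, (D / N * s) ^ (p - 2) * ‖∑ y ∈ Y, a x y * f y‖ ^ 2 := by
        refine Finset.sum_le_sum fun x hx => ?_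
        have e : ‖∑ y ∈ Y, a x y * f y‖ ^ p =
            ‖∑ y ∈ Y, a x y * f y‖ ^ (p - 2) * ‖∑ y ∈ Y, a x y * f y‖ ^ 2 := by
          rw [← Real.rpow_natCast _ 2, ← Real.rpow_add_of_nonneg (norm_nonneg _) (by linarith)
            (by norm_num)]
          congr 1
          push_cast; ring
        rw [e]
        gcongr ?_ ^ _ * _
        exact ha.norm_sum_le f hx
    _ ≤ (D / N * s) ^ (p - 2) * (ε * T) := by
        rw [← Finset.mul_sum]
        gcongr
        exact h2 f
    _ = (D / N) ^ (p - 2) * ε * (s ^ (p - 2) * T) := by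
        rw [Real.mul_rpow (by positivity) hs0]; ring
    _ ≤ (D / N) ^ (p - 2) * ε * (Z ^ (p - 2) * P) := by gcongr
    _ = ((D / N) ^ (p - 2) * Z ^ (p - 2)) * ε * P := by ring
    _ = D ^ (2 * (p - 2)) * ε * P := by
        rw [← Real.mul_rpow (by positivity) hZ0.le, Real.rpow_mul hD0.le]
        congr 3
        rw [hZ, Real.rpow_two]
        field_simp

/-- Split f at height η times its ℓᵖ average. The high part has small ℓ¹ norm because p > 1, and the
trivial bound suffices; the low part goes through ℓ² and Hölder on J. The parameter η balances the
two. -/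
theorem IsWindowKernel.sum_rpow_le_of_lt_two {D N p ε η : ℝ} {J Y : Finset ℤ} {a : ℤ → ℤ → ℂ}
    (ha : IsWindowKernel D N J Y a) (hD : 1 ≤ D) (hN : 0 < N) (hp : 1 < p) (hp2 : p < 2)
    (hε : 0 < ε) (hη : 0 < η)
    (h2 : ∀ f : ℤ → ℂ, ∑ x ∈ J, ‖∑ y ∈ Y, a x y * f y‖ ^ 2 ≤ ε * ∑ y ∈ Y, ‖f y‖ ^ 2)
    (f : ℤ → ℂ) :
    ∑ x ∈ J, ‖∑ y ∈ Y, a x y * f y‖ ^ p ≤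
      2 ^ (p - 1) * ((D * η ^ (1 - p)) ^ p + (ε * η ^ (2 - p)) ^ (p / 2)) *
        ∑ y ∈ Y, ‖f y‖ ^ p := by
  classical
  have hD0 : 0 < D := by linarith
  have hp0 : 0 < p := by linarith
  set P := ∑ y ∈ Y, ‖f y‖ ^ p with hP
  have hP0 : 0 ≤ P := Finset.sum_nonneg fun y _ => by positivity
  rcases hP0.eq_or_lt with hPz | hPpos
  · have hf : ∀ y ∈ Y, f y = 0 := by
      intro y hy
      have := (Finset.sum_eq_zero_iff_of_nonneg (fun y _ => by positivity)).1 hPz.symm y hy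
      rw [Real.rpow_eq_zero (norm_nonneg _) hp0.ne'] at this
      exact norm_eq_zero.1 this
    have hz : ∀ x, ∑ y ∈ Y, a x y * f y = 0 := fun x =>
      Finset.sum_eq_zero fun y hy => by rw [hf y hy, mul_zero]
    simp only [hz, norm_zero, Real.zero_rpow hp0.ne', Finset.sum_const_zero, ← hPz, mul_zero,
      le_refl]
  -- Normalised so that P = N A^p; the powers of N then cancel.
  set A := (P / N) ^ (1 / p) with hA
  have hApos : 0 < A := by positivity
  have hAp : P = N * A ^ p := by
    rw [hA, ← Real.rpow_mul (by positivity), one_div_mul_cancel hp0.ne', Real.rpow_one]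
    field_simp
  set H := η * A with hH
  have hHpos : 0 < H := by positivity
  set f₁ : ℤ → ℂ := fun y => if ‖f y‖ ≤ H then f y else 0 with hf₁
  set f₂ : ℤ → ℂ := fun y => if ‖f y‖ ≤ H then 0 else f y with hf₂
  have hsum : ∀ x, ∑ y ∈ Y, a x y * f y = ∑ y ∈ Y, a x y * f₁ y + ∑ y ∈ Y, a x y * f₂ y := by
    intro x
    rw [← Finset.sum_add_distrib]
    refine Finset.sum_congr rfl fun y _ => ?_
    simp only [hf₁, hf₂]
    split_ifs <;> ring
  have hlarge : ∑ y ∈ Y, ‖f₂ y‖ ≤ H ^ (1 - p) * P := by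
    rw [hP, Finset.mul_sum]
    refine Finset.sum_le_sum fun y _ => ?_
    simp only [hf₂]
    split_ifs with h
    · rw [norm_zero]; positivity
    · push Not at h
      have hpos : 0 < ‖f y‖ := hHpos.trans h
      calc ‖f y‖ = ‖f y‖ ^ (1 - p) * ‖f y‖ ^ p := by
            rw [← Real.rpow_add hpos, sub_add_cancel, Real.rpow_one]
        _ ≤ H ^ (1 - p) * ‖f y‖ ^ p := by
            gcongr ?_ * _
            exact Real.rpow_le_rpow_of_nonpos hHpos h.le (by linarith)
  have hsmall : ∑ y ∈ Y, ‖f₁ y‖ ^ 2 ≤ H ^ (2 - p) * P := by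
    rw [hP, Finset.mul_sum]
    refine Finset.sum_le_sum fun y _ => ?_
    simp only [hf₁]
    split_ifs with h
    · calc ‖f y‖ ^ 2 = ‖f y‖ ^ (2 - p) * ‖f y‖ ^ p := by
            rw [← Real.rpow_add_of_nonneg (norm_nonneg _) (by linarith) hp0.le, sub_add_cancel,
              Real.rpow_two]
        _ ≤ H ^ (2 - p) * ‖f y‖ ^ p := by
            gcongr
    · rw [norm_zero, zero_pow two_ne_zero]; positivity
  have hu₂ : ∑ x ∈ J, ‖∑ y ∈ Y, a x y * f₂ y‖ ^ p ≤ (D * η ^ (1 - p)) ^ p * P := by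
    calc _ ≤ ∑ x ∈ J, (D / N * (H ^ (1 - p) * P)) ^ p := by
          refine Finset.sum_le_sum fun x hx => ?_
          gcongr ?_ ^ _
          refine (ha.norm_sum_le f₂ hx).trans ?_
          gcongr
      _ ≤ N * (D / N * (H ^ (1 - p) * P)) ^ p := by
          rw [Finset.sum_const, nsmul_eq_mul]
          gcongr
          exact ha.card_left
      _ = (D * η ^ (1 - p)) ^ p * P := by
          have e : D / N * (H ^ (1 - p) * P) = D * η ^ (1 - p) * A := by
            rw [hH, hAp, Real.mul_rpow hη.le hApos.le]
            have : A ^ (1 - p) * A ^ p = A := by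
              rw [← Real.rpow_add hApos, sub_add_cancel, Real.rpow_one]
            calc _ = D * η ^ (1 - p) * (A ^ (1 - p) * A ^ p) := by field_simp
              _ = _ := by rw [this]
          rw [e, Real.mul_rpow (by positivity) hApos.le, hAp]
          ring
  have hu₁ : ∑ x ∈ J, ‖∑ y ∈ Y, a x y * f₁ y‖ ^ p ≤ (ε * η ^ (2 - p)) ^ (p / 2) * P := by
    set U := ∑ x ∈ J, ‖∑ y ∈ Y, a x y * f₁ y‖ ^ p with hU
    have hU0 : 0 ≤ U := Finset.sum_nonneg fun y _ => by positivity
    have h5 : U ^ (2 / p) ≤ N ^ (2 / p - 1) * (ε * (H ^ (2 - p) * P)) := by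
      have := rpow_sum_norm_le ha.card_left (r := 2 / p) (by rw [le_div_iff₀ hp0]; linarith)
        (v := fun x => ‖∑ y ∈ Y, a x y * f₁ y‖ ^ p) fun x => by positivity
      refine this.trans ?_
      gcongr
      refine le_trans (le_of_eq ?_) ((h2 f₁).trans (by gcongr))
      refine Finset.sum_congr rfl fun x _ => ?_
      rw [← Real.rpow_mul (norm_nonneg _), mul_div_cancel₀ _ hp0.ne', Real.rpow_two]
    have h6 : U ≤ (N ^ (2 / p - 1) * (ε * (H ^ (2 - p) * P))) ^ (p / 2) := by
      calc U = (U ^ (2 / p)) ^ (p / 2) := by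
            rw [← Real.rpow_mul hU0, div_mul_div_cancel₀ hp0.ne', div_self two_ne_zero,
              Real.rpow_one]
        _ ≤ _ := by gcongr
    refine h6.trans_eq ?_
    have e : N ^ (2 / p - 1) * (ε * (H ^ (2 - p) * P)) =
        (ε * η ^ (2 - p)) * (N ^ (2 / p) * A ^ (2 : ℝ)) := by
      rw [hH, hAp, Real.mul_rpow hη.le hApos.le, Real.rpow_sub_one hN.ne']
      have : A ^ (2 - p) * A ^ p = A ^ (2 : ℝ) := by
        rw [← Real.rpow_add hApos, sub_add_cancel]
      rw [← this]
      field_simp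
    rw [e, Real.mul_rpow (by positivity) (by positivity), hAp,
      Real.mul_rpow (x := N ^ (2 / p)) (by positivity) (by positivity), ← Real.rpow_mul hN.le,
      ← Real.rpow_mul hApos.le, div_mul_div_cancel₀ hp0.ne', div_self two_ne_zero, Real.rpow_one,
      mul_div_cancel₀ _ two_ne_zero]
  calc ∑ x ∈ J, ‖∑ y ∈ Y, a x y * f y‖ ^ p
      ≤ ∑ x ∈ J, 2 ^ (p - 1) * (‖∑ y ∈ Y, a x y * f₁ y‖ ^ p + ‖∑ y ∈ Y, a x y * f₂ y‖ ^ p) := by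
        refine Finset.sum_le_sum fun x _ => ?_
        rw [hsum]
        calc _ ≤ (‖∑ y ∈ Y, a x y * f₁ y‖ + ‖∑ y ∈ Y, a x y * f₂ y‖) ^ p := by
              gcongr
              exact norm_add_le _ _
          _ ≤ _ := by
              exact_mod_cast NNReal.rpow_add_le_mul_rpow_add_rpow ‖∑ y ∈ Y, a x y * f₁ y‖₊
                ‖∑ y ∈ Y, a x y * f₂ y‖₊ hp.le
    _ ≤ 2 ^ (p - 1) * ((ε * η ^ (2 - p)) ^ (p / 2) * P + (D * η ^ (1 - p)) ^ p * P) := by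
        rw [← Finset.mul_sum, Finset.sum_add_distrib]
        gcongr
    _ = _ := by ring

/-- A power gain in `ℓ²` on a window gives a gain of `T⁻²` in `ℓᵖ`. -/
theorem exists_window_gain {p : ℝ} (hp : 1 < p) : ∃ κ : ℕ, ∀ D : ℝ, 1 ≤ D → ∃ C : ℝ, 0 < C ∧
    ∀ (N T : ℝ), 0 < N → 1 ≤ T → ∀ (J Y : Finset ℤ) (a : ℤ → ℤ → ℂ), IsWindowKernel D N J Y a →
      (∀ f : ℤ → ℂ,
        ∑ x ∈ J, ‖∑ y ∈ Y, a x y * f y‖ ^ 2 ≤ D / T ^ κ * ∑ y ∈ Y, ‖f y‖ ^ 2) →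
      ∀ f : ℤ → ℂ, ∑ x ∈ J, ‖∑ y ∈ Y, a x y * f y‖ ^ p ≤
        C * T ^ (-(2 * p)) * ∑ y ∈ Y, ‖f y‖ ^ p := by
  rcases le_or_gt 2 p with hp2 | hp2
  · refine ⟨⌈2 * p⌉₊, fun D hD => ⟨D ^ (2 * (p - 2)) * D, by positivity, ?_⟩⟩
    intro N T hN hT J Y a ha h2 f
    refine (ha.sum_rpow_le_of_two_le hD hN hp2 (by positivity) h2 f).trans ?_
    have h0 : 0 ≤ ∑ y ∈ Y, ‖f y‖ ^ p := Finset.sum_nonneg fun y _ => by positivity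
    have hT0 : 0 < T := by linarith
    have h1 : T ^ (2 * p) ≤ T ^ ⌈2 * p⌉₊ := by
      rw [← Real.rpow_natCast]
      exact Real.rpow_le_rpow_of_exponent_le hT (Nat.le_ceil _)
    rw [Real.rpow_neg hT0.le, mul_assoc (D ^ _) D, ← div_eq_mul_inv]
    gcongr
  -- With η = T^{2/(p-1)} the high part contributes T^{-2p}. The exponent e makes T^{-e}η^{2-p} =
  -- T⁻⁴, whose power p/2 is again T^{-2p}.
  · set e := 4 + 2 * (2 - p) / (p - 1) with he
    refine ⟨⌈e⌉₊, fun D hD => ⟨2 ^ (p - 1) * (D ^ p + D ^ (p / 2)), by positivity, ?_⟩⟩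
    intro N T hN hT J Y a ha h2 f
    have hT0 : 0 < T := by linarith
    have hD0 : 0 < D := by linarith
    have hp1 : 0 < p - 1 := by linarith
    refine (ha.sum_rpow_le_of_lt_two hD hN hp hp2 (by positivity)
      (η := T ^ (2 / (p - 1))) (by positivity) h2 f).trans ?_
    have h0 : 0 ≤ ∑ y ∈ Y, ‖f y‖ ^ p := Finset.sum_nonneg fun y _ => by positivity
    have h1 : (D * (T ^ (2 / (p - 1))) ^ (1 - p)) ^ p = D ^ p * T ^ (-(2 * p)) := by
      rw [Real.mul_rpow hD0.le (by positivity), ← Real.rpow_mul hT0.le, ← Real.rpow_mul hT0.le]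
      congr 2
      field_simp
      ring
    have h3 : (D / T ^ ⌈e⌉₊ * (T ^ (2 / (p - 1))) ^ (2 - p)) ^ (p / 2) ≤
        D ^ (p / 2) * T ^ (-(2 * p)) := by
      have h4 : D / T ^ ⌈e⌉₊ * (T ^ (2 / (p - 1))) ^ (2 - p) ≤ D * T ^ (-4 : ℝ) := by
        have h5 : T ^ e ≤ T ^ ⌈e⌉₊ := by
          rw [← Real.rpow_natCast]
          exact Real.rpow_le_rpow_of_exponent_le hT (Nat.le_ceil _)
        calc _ ≤ D / T ^ e * (T ^ (2 / (p - 1))) ^ (2 - p) := by gcongr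
          _ = D * T ^ (-4 : ℝ) := by
            rw [div_eq_mul_inv, ← Real.rpow_neg hT0.le, ← Real.rpow_mul hT0.le, mul_assoc,
              ← Real.rpow_add hT0]
            congr 2
            rw [he]
            field_simp
            ring
      calc _ ≤ (D * T ^ (-4 : ℝ)) ^ (p / 2) := by gcongr
        _ = _ := by
          rw [Real.mul_rpow hD0.le (by positivity), ← Real.rpow_mul hT0.le]
          congr 2
          ring
    rw [h1]
    calc _ ≤ 2 ^ (p - 1) * (D ^ p * T ^ (-(2 * p)) + D ^ (p / 2) * T ^ (-(2 * p))) *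
          ∑ y ∈ Y, ‖f y‖ ^ p := by gcongr
      _ = _ := by ring

/-! ### The linearised operator and its kernel -/

/-- The support, size and Lipschitz constant of `ψ` are at most `D`. -/
structure IsBumpBound (D : ℕ) (ψ : ℝ → ℝ) : Prop where
  one_le : 1 ≤ D
  support : ∀ x, ψ x ≠ 0 → |x| ≤ D
  bound : ∀ x, |ψ x| ≤ D
  lipschitz : ∀ x y, |ψ x - ψ y| ≤ D * |x - y|

theorem exists_isBumpBound {ψ : ℝ → ℝ} (hψ : ContDiff ℝ ∞ ψ) (hc : HasCompactSupport ψ) :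
    ∃ D : ℕ, IsBumpBound D ψ := by
  obtain ⟨L, hL⟩ := (hψ.of_le (by exact_mod_cast le_top) :
    ContDiff ℝ 1 ψ).lipschitzWith_of_hasCompactSupport hc one_ne_zero
  obtain ⟨M, hM⟩ := hc.exists_bound_of_continuous hψ.continuous
  obtain ⟨R, hR⟩ := hc.isCompact.isBounded.exists_norm_le
  obtain ⟨D, hD⟩ := exists_nat_ge (max (max (L : ℝ) M) (max R 1))
  simp only [max_le_iff] at hD
  obtain ⟨⟨h1, h2⟩, h3, h4⟩ := hD
  refine ⟨D, by exact_mod_cast h4, fun x hx => ?_, fun x => (hM x).trans h2, fun x y => ?_⟩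
  · exact (hR x (subset_tsupport _ hx)).trans h3
  · have := hL.dist_le_mul x y
    rw [Real.dist_eq, Real.dist_eq] at this
    exact this.trans (mul_le_mul_of_nonneg_right h1 (abs_nonneg _))

/-- The matrix of the linearised operator `f ↦ ∑_m f(x-m) ψ_j(m) e(-l(x) m^d)`. -/
noncomputable def modulatedMatrix (d : ℕ) (ψ : ℝ → ℝ) (j : ℕ) (l : ℤ → ℝ) (x y : ℤ) : ℂ :=
  (dyadicDilate ψ j ((x - y : ℤ) : ℝ) : ℂ) * charE (-(l x * ((x - y : ℤ) : ℝ) ^ d))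

/-- The window `[b, b + N)`. -/
noncomputable def window (N : ℕ) (b : ℤ) : Finset ℤ := Finset.Ico b (b + N)

/-- The window `[b - D N, b + N + D N)`. -/
noncomputable def wideWindow (D N : ℕ) (b : ℤ) : Finset ℤ := Finset.Ico (b - D * N) (b + (N + D * N))

theorem IsBumpBound.dyadicDilate_ne_zero {D : ℕ} {ψ : ℝ → ℝ} (hψ : IsBumpBound D ψ) {j : ℕ}
    {m : ℤ} (hm : dyadicDilate ψ j m ≠ 0) : |m| ≤ D * (2 ^ j : ℕ) := by
  have h1 := hψ.support _ (right_ne_zero_of_mul hm)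
  rw [abs_mul, abs_of_pos (by positivity), inv_mul_le_iff₀ (by positivity)] at h1
  have : (|m| : ℝ) ≤ D * (2 ^ j : ℕ) := by
    push_cast
    linarith
  exact_mod_cast this

theorem IsBumpBound.abs_dyadicDilate_le {D : ℕ} {ψ : ℝ → ℝ} (hψ : IsBumpBound D ψ) (j : ℕ)
    (x : ℝ) : |dyadicDilate ψ j x| ≤ D / (2 ^ j : ℕ) := by
  unfold dyadicDilate
  rw [abs_mul, abs_of_pos (by positivity), div_eq_inv_mul]
  push_cast
  gcongr
  exact hψ.bound _

theorem IsBumpBound.modulatedSum_eq {D : ℕ} {ψ : ℝ → ℝ} (hψ : IsBumpBound D ψ) {d j : ℕ}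
    (l : ℤ → ℝ) (f : ℤ → ℂ) {b x : ℤ} (hx : x ∈ window (2 ^ j) b) :
    modulatedSum d ψ j (l x) f x =
      ∑ y ∈ wideWindow D (2 ^ j) b, modulatedMatrix d ψ j l x y * f y := by
  unfold modulatedSum
  rw [← (Equiv.subLeft x).tsum_eq]
  rw [tsum_eq_sum (s := wideWindow D (2 ^ j) b)]
  · refine Finset.sum_congr rfl fun y _ => ?_
    simp only [modulatedMatrix, Equiv.subLeft_apply, sub_sub_cancel]
    ring
  · intro y hy
    have : dyadicDilate ψ j ((x - y : ℤ) : ℝ) = 0 := by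
      by_contra hne
      have h1 := abs_le.1 (hψ.dyadicDilate_ne_zero hne)
      apply hy
      rw [window, Finset.mem_Ico] at hx
      rw [wideWindow, Finset.mem_Ico]
      omega
    simp only [Equiv.subLeft_apply, this, Complex.ofReal_zero, mul_zero, zero_mul]

theorem IsBumpBound.isWindowKernel {D : ℕ} {ψ : ℝ → ℝ} (hψ : IsBumpBound D ψ) (d j : ℕ)
    (l : ℤ → ℝ) (b : ℤ) :
    IsWindowKernel (4 * D ^ 3) (2 ^ j : ℕ) (window (2 ^ j) b) (wideWindow D (2 ^ j) b)
      (modulatedMatrix d ψ j l) := by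
  have hD : (1 : ℝ) ≤ D := by exact_mod_cast hψ.one_le
  have hD3 : (D : ℝ) ≤ (D : ℝ) ^ 3 := le_self_pow₀ hD (by norm_num)
  refine ⟨?_, ?_, fun x _ y _ => ?_⟩
  · rw [window, Int.card_Ico, add_sub_cancel_left, Int.toNat_natCast]
  · have : (wideWindow D (2 ^ j) b).card = (2 * D + 1) * 2 ^ j := by
      rw [wideWindow, Int.card_Ico]
      have : (b + (((2 ^ j : ℕ) : ℤ) + D * (2 ^ j : ℕ)) - (b - D * (2 ^ j : ℕ))) =
          (((2 * D + 1) * 2 ^ j : ℕ) : ℤ) := by push_cast; ring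
      rw [this, Int.toNat_natCast]
    rw [this]
    push_cast
    gcongr
    linarith
  · rw [modulatedMatrix, norm_mul, norm_charE, mul_one, Complex.norm_real, Real.norm_eq_abs]
    refine (hψ.abs_dyadicDilate_le j _).trans ?_
    gcongr
    linarith

theorem card_wideWindow_le {D N : ℕ} (hD : 1 ≤ D) (b : ℤ) :
    (wideWindow D N b).card ≤ 3 * D * N := by
  rw [wideWindow, Int.card_Ico]
  have : b + ((N : ℤ) + D * N) - (b - D * N) = (((2 * D + 1) * N : ℕ) : ℤ) := by push_cast; ring
  rw [this, Int.toNat_natCast]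
  exact Nat.mul_le_mul_right _ (by omega)

/-- The weight in the `TT*` kernel at displacement `n`. -/
noncomputable def kernelWeight (ψ : ℝ → ℝ) (N : ℕ) (n m : ℤ) : ℝ :=
  ψ ((N : ℝ)⁻¹ * ((m - n : ℤ) : ℝ)) * ψ ((N : ℝ)⁻¹ * m)

theorem IsBumpBound.isScaleWeight {D : ℕ} {ψ : ℝ → ℝ} (hψ : IsBumpBound D ψ) {Q N : ℕ}
    (hQ : 2 * D ^ 2 ≤ Q) (hN : 1 ≤ N) (n : ℤ) : IsScaleWeight Q N (kernelWeight ψ N n) := by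
  have hD : (1 : ℝ) ≤ D := by exact_mod_cast hψ.one_le
  have hQ' : 2 * (D : ℝ) ^ 2 ≤ Q := by exact_mod_cast hQ
  have hN' : (0 : ℝ) < N := by exact_mod_cast hN
  refine ⟨fun m hm => ?_, fun m => ?_, fun m m' => ?_⟩
  · have h1 := hψ.support _ (right_ne_zero_of_mul hm)
    rw [abs_mul, abs_of_pos (by positivity), inv_mul_le_iff₀ hN'] at h1
    have hDQ : (D : ℝ) ≤ Q := by nlinarith
    have : (|m| : ℝ) ≤ Q * N := by nlinarith
    exact_mod_cast this
  · rw [kernelWeight, abs_mul]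
    calc _ ≤ (D : ℝ) * D := mul_le_mul (hψ.bound _) (hψ.bound _) (abs_nonneg _) (by positivity)
      _ ≤ Q := by nlinarith
  · have key : ∀ u v : ℝ, |ψ ((N : ℝ)⁻¹ * u) - ψ ((N : ℝ)⁻¹ * v)| ≤ D * (|u - v| / N) := by
      intro u v
      refine (hψ.lipschitz _ _).trans_eq ?_
      rw [← mul_sub, abs_mul, abs_of_pos (by positivity : (0 : ℝ) < (N : ℝ)⁻¹)]
      ring
    have e : kernelWeight ψ N n m - kernelWeight ψ N n m' =
        (ψ ((N : ℝ)⁻¹ * ((m - n : ℤ) : ℝ)) - ψ ((N : ℝ)⁻¹ * ((m' - n : ℤ) : ℝ))) *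
          ψ ((N : ℝ)⁻¹ * m) +
        ψ ((N : ℝ)⁻¹ * ((m' - n : ℤ) : ℝ)) * (ψ ((N : ℝ)⁻¹ * m) - ψ ((N : ℝ)⁻¹ * m')) := by
      unfold kernelWeight; ring
    rw [e]
    refine (abs_add_le _ _).trans ?_
    rw [abs_mul, abs_mul]
    have h1 := key ((m - n : ℤ) : ℝ) ((m' - n : ℤ) : ℝ)
    have h2 := key (m : ℝ) m'
    have e3 : ((m - n : ℤ) : ℝ) - ((m' - n : ℤ) : ℝ) = m - m' := by push_cast; ring
    rw [e3] at h1
    have h0 : 0 ≤ |(m : ℝ) - m'| / N := by positivity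
    calc _ ≤ D * (|(m : ℝ) - m'| / N) * D + D * (D * (|(m : ℝ) - m'| / N)) := by
          gcongr
          · exact hψ.bound _
          · exact hψ.bound _
      _ = 2 * (D : ℝ) ^ 2 * (|(m : ℝ) - m'| / N) := by ring
      _ ≤ Q * (|(m : ℝ) - m'| / N) := by gcongr
      _ = _ := by ring

/-- Substitute m = x' - y. As x' lies in the window, every m in the support of the weight comes from
a y in the wide window, so no term is lost. -/
theorem IsBumpBound.kernel_eq {D : ℕ} {ψ : ℝ → ℝ} (hψ : IsBumpBound D ψ) {d j Q : ℕ}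
    (hQ : D ≤ Q) (l : ℤ → ℝ) {b x x' : ℤ} (hx' : x' ∈ window (2 ^ j) b) :
    ∑ y ∈ wideWindow D (2 ^ j) b,
        (starRingEnd ℂ) (modulatedMatrix d ψ j l x y) * modulatedMatrix d ψ j l x' y =
      (((2 ^ j : ℕ) : ℂ)⁻¹) ^ 2 *
        ∑ m ∈ Finset.Icc (-(Q * (2 ^ j : ℕ) : ℤ)) (Q * (2 ^ j : ℕ)),
          (kernelWeight ψ (2 ^ j) (x' - x) m : ℂ) *
          charE (l x * ((m : ℝ) - ((x' - x : ℤ) : ℝ)) ^ d - l x' * (m : ℝ) ^ d) := by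
  have hterm : ∀ y, (starRingEnd ℂ) (modulatedMatrix d ψ j l x y) * modulatedMatrix d ψ j l x' y =
      (((2 ^ j : ℕ) : ℂ)⁻¹) ^ 2 * ((kernelWeight ψ (2 ^ j) (x' - x) (x' - y) : ℂ) *
        charE (l x * (((x' - y : ℤ) : ℝ) - ((x' - x : ℤ) : ℝ)) ^ d -
          l x' * ((x' - y : ℤ) : ℝ) ^ d)) := by
    intro y
    have e1 : x' - y - (x' - x) = x - y := by ring
    have e2 : ((x' - y : ℤ) : ℝ) - ((x' - x : ℤ) : ℝ) = ((x - y : ℤ) : ℝ) := by push_cast; ring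
    simp only [modulatedMatrix, kernelWeight, dyadicDilate, map_mul, Complex.conj_ofReal,
      conj_charE, e1, e2, neg_neg, sub_eq_add_neg (l x * _), charE_add]
    push_cast
    ring
  have hzero : ∀ y, |x' - y| ≤ D * (2 ^ j : ℕ) ∨
      kernelWeight ψ (2 ^ j) (x' - x) (x' - y) = 0 := by
    intro y
    by_contra hcon
    push Not at hcon
    have h1 := right_ne_zero_of_mul hcon.2
    have h2 := hψ.dyadicDilate_ne_zero (j := j) (m := x' - y)
      (by unfold dyadicDilate; push_cast at h1 ⊢; exact mul_ne_zero (by positivity) h1)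
    omega
  simp only [hterm]
  rw [← Finset.mul_sum]
  congr 1
  have hQN : (D : ℤ) * (2 ^ j : ℕ) ≤ Q * (2 ^ j : ℕ) :=
    mul_le_mul_of_nonneg_right (by exact_mod_cast hQ) (by positivity)
  rw [window, Finset.mem_Ico] at hx'
  refine Finset.sum_bij_ne_zero (fun y _ _ => x' - y) ?_ ?_ ?_ ?_
  · intro y _ hne
    rcases hzero y with h | h
    · rw [abs_le] at h
      rw [Finset.mem_Icc]
      omega
    · exact absurd (by rw [h, Complex.ofReal_zero, zero_mul]) hne
  · intro y _ _ y' _ _ h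
    linarith
  · intro m _ hne
    rcases hzero (x' - m) with h | h
    · rw [sub_sub_cancel, abs_le] at h
      refine ⟨x' - m, ?_, ?_, sub_sub_cancel _ _⟩
      · rw [wideWindow, Finset.mem_Ico]
        omega
      · rw [sub_sub_cancel]
        exact hne
    · rw [sub_sub_cancel] at h
      exact absurd (by rw [h, Complex.ofReal_zero, zero_mul]) hne
  · intro y _ _
    rfl

/-- The Schur bound for the `TT*` kernel restricted to frequencies away from rationals with small
denominator. -/
theorem exists_schur_bound (k : ℕ) : ∃ C : ℕ, ∀ (D : ℕ) (ψ : ℝ → ℝ), IsBumpBound D ψ →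
    ∀ Q j : ℕ, 2 * D ^ 2 ≤ Q → Q ^ C ≤ 2 ^ j → ∀ l : ℤ → ℝ,
      (∀ x, ∀ q : ℕ, 1 ≤ q → q ≤ Q ^ C →
        ¬ NearInt ((Q : ℝ) ^ C / ((2 ^ j : ℕ) : ℝ) ^ (k + 2)) (q * l x)) →
      ∀ b : ℤ, ∀ x ∈ window (2 ^ j) b, ∑ x' ∈ window (2 ^ j) b,
        ‖∑ y ∈ wideWindow D (2 ^ j) b, (starRingEnd ℂ) (modulatedMatrix (k + 2) ψ j l x y) *
          modulatedMatrix (k + 2) ψ j l x' y‖ ≤ 4 * (D : ℝ) ^ 3 / Q := by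
  classical
  obtain ⟨C, hC⟩ := card_large_kernel_le k
  refine ⟨C, fun D ψ hψ Q j hQ hN l hl b x hx => ?_⟩
  set N : ℕ := 2 ^ j with hNdef
  have hN1 : 1 ≤ N := Nat.one_le_two_pow
  have hNpos : (0 : ℝ) < N := by exact_mod_cast hN1
  have hD1 := hψ.one_le
  have hD : (1 : ℝ) ≤ D := by exact_mod_cast hD1
  have hQ2 : 2 ≤ Q := by nlinarith
  have hDQ : D ≤ Q := by nlinarith
  have hQpos : (0 : ℝ) < Q := by positivity
  -- Row x fixes μ = l x, while the second frequency l (x + n) may depend on n.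
  have hcard := hC Q N hQ2 hN (l x) (hl x) (fun n => kernelWeight ψ N n) (fun n => l (x + n))
    (hψ.isScaleWeight hQ hN1)
  set E : ℤ → ℝ := fun n => ‖∑ m ∈ Finset.Icc (-(Q * N : ℤ)) (Q * N), (kernelWeight ψ N n m : ℂ) *
          charE (l x * ((m : ℝ) - n) ^ (k + 2) - l (x + n) * (m : ℝ) ^ (k + 2))‖ with hE
  set H := (Finset.Icc (-(Q * N : ℤ)) (Q * N)).filter (fun n => (N : ℝ) ≤ Q * E n)
  set Kf : ℤ → ℝ := fun x' => ‖∑ y ∈ wideWindow D N b,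
    (starRingEnd ℂ) (modulatedMatrix (k + 2) ψ j l x y) * modulatedMatrix (k + 2) ψ j l x' y‖
    with hKf
  have hKE : ∀ x' ∈ window N b, Kf x' = (N : ℝ)⁻¹ ^ 2 * E (x' - x) := by
    intro x' hx'
    rw [hKf]
    simp only
    rw [hψ.kernel_eq hDQ l hx', norm_mul, norm_pow, norm_inv, Complex.norm_natCast, hE]
    simp only [add_sub_cancel]
    rfl
  have hKtriv : ∀ x', Kf x' ≤ 3 * (D : ℝ) ^ 3 / N := by
    intro x'
    have h1 : ∀ z y, ‖modulatedMatrix (k + 2) ψ j l z y‖ ≤ D / N := by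
      intro z y
      rw [modulatedMatrix, norm_mul, norm_charE, mul_one, Complex.norm_real, Real.norm_eq_abs]
      exact hψ.abs_dyadicDilate_le j _
    calc Kf x' ≤ ∑ y ∈ wideWindow D N b, (D : ℝ) / N * (D / N) := by
          refine norm_sum_le_of_le _ fun y _ => ?_
          rw [norm_mul, RCLike.norm_conj]
          exact mul_le_mul (h1 _ _) (h1 _ _) (norm_nonneg _) (by positivity)
      _ ≤ (3 * D * N : ℕ) * ((D : ℝ) / N * (D / N)) := by
          rw [Finset.sum_const, nsmul_eq_mul]
          gcongr
          exact card_wideWindow_le hD1 b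
      _ = _ := by push_cast; field_simp
  have hx0 := Finset.mem_Ico.1 hx
  have hbad : ((window N b).filter (fun x' => (N : ℝ) ≤ Q * E (x' - x))).card ≤ H.card := by
    refine Finset.card_le_card_of_injOn (fun x' => x' - x) ?_ ?_
    · intro x' hx'
      obtain ⟨h1, h2⟩ := Finset.mem_filter.1 hx'
      rw [window, Finset.mem_Ico] at h1
      refine Finset.mem_filter.2 ⟨Finset.mem_Icc.2 ?_, h2⟩
      have : (N : ℤ) ≤ Q * N := by
        exact_mod_cast Nat.le_mul_of_pos_left N (by omega : 0 < Q)
      dsimp only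
      constructor <;> omega
    · intro x' _ x'' _ h
      simpa using h
  have hwin : ((window N b).card : ℝ) = N := by
    rw [window, Int.card_Ico, add_sub_cancel_left, Int.toNat_natCast]
  -- At most N/Q bad columns carry the trivial bound 3D³/N, and each of the others at most 1/(NQ).
  calc ∑ x' ∈ window N b, Kf x' ≤ ∑ x' ∈ window N b,
        ((if (N : ℝ) ≤ Q * E (x' - x) then 3 * (D : ℝ) ^ 3 / N else 0) + 1 / ((N : ℝ) * Q)) := by
        refine Finset.sum_le_sum fun x' hx' => ?_
        split_ifs with h
        · have : (0 : ℝ) ≤ 1 / (N * Q) := by positivity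
          linarith [hKtriv x']
        · push Not at h
          rw [zero_add, hKE x' hx']
          have : E (x' - x) ≤ N / Q := by
            rw [le_div_iff₀ hQpos]; linarith
          calc _ ≤ (N : ℝ)⁻¹ ^ 2 * (N / Q) := by gcongr
            _ = _ := by field_simp
    _ = ((window N b).filter (fun x' => (N : ℝ) ≤ Q * E (x' - x))).card * (3 * (D : ℝ) ^ 3 / N) +
        N * (1 / (N * Q)) := by
        rw [Finset.sum_add_distrib, ← Finset.sum_filter, Finset.sum_const, Finset.sum_const,
          nsmul_eq_mul, nsmul_eq_mul, hwin]
    _ ≤ (N / Q) * (3 * (D : ℝ) ^ 3 / N) + N * (1 / (N * Q)) := by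
        gcongr
        rw [le_div_iff₀ hQpos]
        have : ((window N b).filter (fun x' => (N : ℝ) ≤ Q * E (x' - x))).card * Q ≤ N :=
          (Nat.mul_le_mul_right _ hbad).trans hcard
        exact_mod_cast this
    _ = (3 * (D : ℝ) ^ 3 + 1) / Q := by field_simp
    _ ≤ 4 * (D : ℝ) ^ 3 / Q := by
        gcongr
        linarith [one_le_pow₀ hD (n := 3)]

/-- Reducing b/q to lowest terms only shrinks the denominator, so an approximation of qμ by b would
place μ in the exceptional set. -/
theorem not_nearInt_of_notMem_exceptionalSet {d j q : ℕ} {C A B μ M : ℝ}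
    (hμ : μ ∉ exceptionalSet d C A B j) (hq : 1 ≤ q) (hqM : (q : ℝ) ≤ M)
    (hA : M ≤ A * (j : ℝ) ^ C) (hB : M ≤ B * (j : ℝ) ^ C) :
    ¬ NearInt (M / ((2 ^ j : ℕ) : ℝ) ^ d) (q * μ) := by
  rintro ⟨b, hb⟩
  apply hμ
  have hq' : (1 : ℝ) ≤ q := by exact_mod_cast hq
  have hq0 : (0 : ℝ) < q := by linarith
  set r : ℚ := (b : ℚ) / q with hr
  have hden : r.den ≤ q := by
    have : (r.den : ℤ) ∣ (q : ℤ) := by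
      have := Rat.den_dvd b q
      rwa [Rat.divInt_eq_div, Int.cast_natCast] at this
    exact Nat.le_of_dvd hq (by exact_mod_cast this)
  have hrR : (r : ℝ) = b / q := by rw [hr]; push_cast; rfl
  refine Set.mem_add.2 ⟨r, ⟨r.num, r.den, r.den_pos, ?_, ?_, ?_⟩, μ - r, ?_, by ring⟩
  · have : (r.den : ℝ) ≤ q := by exact_mod_cast hden
    linarith
  · rw [Int.isCoprime_iff_gcd_eq_one]
    exact r.reduced
  · exact Rat.cast_def r
  · rw [Set.mem_ofPred_eq, hrR]
    have e : μ - b / q = (q * μ - b) / q := by field_simp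
    rw [e, abs_div, abs_of_pos hq0]
    have h2 : (((2 ^ j : ℕ) : ℝ) ^ d) = (2 : ℝ) ^ (d * j) := by
      push_cast
      rw [← pow_mul, mul_comm]
    rw [h2] at hb
    calc |q * μ - b| / q ≤ |q * μ - b| := div_le_self (abs_nonneg _) hq'
      _ ≤ M / (2 : ℝ) ^ (d * j) := hb
      _ ≤ _ := by
        rw [div_eq_mul_inv]
        gcongr

/-! ### From windows to the whole line, and the theorem -/

theorem tsum_sum_Ico_add (F : ℤ → ℝ≥0∞) (u v : ℤ) :
    ∑' b : ℤ, ∑ x ∈ Finset.Ico (b + u) (b + v), F x = ((v - u).toNat : ℝ≥0∞) * ∑' x, F x := by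
  have h1 : ∀ b : ℤ, ∑ x ∈ Finset.Ico (b + u) (b + v), F x = ∑ s ∈ Finset.Ico u v, F (b + s) := by
    intro b
    rw [← Finset.image_add_left_Ico, Finset.sum_image]
    intro s _ t _ h
    simpa using h
  simp only [h1]
  rw [Summable.tsum_finsetSum fun _ _ => ENNReal.summable]
  have h2 : ∀ s : ℤ, ∑' b : ℤ, F (b + s) = ∑' x, F x := fun s => (Equiv.addRight s).tsum_eq F
  simp only [h2, Finset.sum_const, Int.card_Ico, nsmul_eq_mul]

/-- Local estimates on all windows of length `N` imply a global estimate. -/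
theorem tsum_le_of_window {D N : ℕ} (hN : 1 ≤ N) {M F : ℤ → ℝ≥0∞} {c : ℝ≥0∞}
    (h : ∀ b, ∑ x ∈ window N b, M x ≤ c * ∑ y ∈ wideWindow D N b, F y) :
    ∑' x, M x ≤ c * (2 * D + 1 : ℕ) * ∑' y, F y := by
  have h1 := tsum_sum_Ico_add M 0 N
  have h2 := tsum_sum_Ico_add F (-(D * N)) (N + D * N)
  have e : ((N : ℤ) + D * N - -(D * N)).toNat = N * (2 * D + 1) := by
    have : (N : ℤ) + D * N - -(D * N) = ((N * (2 * D + 1) : ℕ) : ℤ) := by push_cast; ring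
    rw [this, Int.toNat_natCast]
  rw [e] at h2
  simp only [sub_zero, Int.toNat_natCast, add_zero, ← sub_eq_add_neg] at h1 h2
  -- Each point lies in N windows and in N(2D + 1) wide windows; the common factor N cancels.
  have h3 : (N : ℝ≥0∞) * ∑' x, M x ≤ N * (c * (2 * D + 1 : ℕ) * ∑' y, F y) := by
    rw [← h1]
    refine (ENNReal.tsum_le_tsum h).trans ?_
    rw [ENNReal.tsum_mul_left]
    simp only [wideWindow]
    rw [h2]
    push_cast
    exact le_of_eq (by ring)
  rwa [ENNReal.mul_le_mul_iff_right (by simp; omega) (ENNReal.natCast_ne_top N)] at h3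

/-- A maximal function is controlled on a window by its linearisations. -/
theorem sum_iSup_rpow_le {d j : ℕ} {ψ : ℝ → ℝ} {X : Set ℝ} {f : ℤ → ℂ} {J Y : Finset ℤ} {p c : ℝ}
    (hp : 0 < p) (hc : 0 ≤ c) (hfin : ∀ x, restrictedMaximal d ψ j X f x ≠ ⊤)
    (h : ∀ l : ℤ → ℝ, (∀ x, l x ∉ X) →
      ∑ x ∈ J, ‖modulatedSum d ψ j (l x) f x‖ ^ p ≤ c * ∑ y ∈ Y, ‖f y‖ ^ p) :
    ∑ x ∈ J, restrictedMaximal d ψ j X f x ^ p ≤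
      ENNReal.ofReal (2 ^ p * c) * ∑ y ∈ Y, ‖f y‖ₑ ^ p := by
  have hen : ∀ z : ℂ, ‖z‖ₑ ^ p = ENNReal.ofReal (‖z‖ ^ p) := by
    intro z
    rw [← ofReal_norm, ENNReal.ofReal_rpow_of_nonneg (norm_nonneg _) hp.le]
  -- If X is all of ℝ there is no frequency to choose, and the supremum is 0.
  rcases Set.eq_empty_or_nonempty Xᶜ with hX | ⟨l₀, hl₀⟩
  · have : ∀ x, restrictedMaximal d ψ j X f x = 0 := by
      intro x
      simp [restrictedMaximal, hX]
    simp only [this, ENNReal.zero_rpow_of_pos hp, Finset.sum_const_zero, zero_le]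
  have hex : ∀ x, ∃ l : ℝ, l ∉ X ∧
      restrictedMaximal d ψ j X f x ≤ 2 * ‖modulatedSum d ψ j l f x‖ₑ := by
    intro x
    by_cases h0 : restrictedMaximal d ψ j X f x = 0
    · exact ⟨l₀, hl₀, by rw [h0]; exact zero_le⟩
    · have h1 : restrictedMaximal d ψ j X f x / 2 < restrictedMaximal d ψ j X f x :=
        ENNReal.half_lt_self h0 (hfin x)
      conv_rhs at h1 => rw [restrictedMaximal]
      obtain ⟨l, hl, hlt⟩ := lt_biSup_iff.1 h1
      refine ⟨l, hl, ?_⟩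
      rw [mul_comm]
      exact (ENNReal.div_le_iff (by norm_num) (by norm_num)).1 hlt.le
  choose l hl hle using hex
  calc ∑ x ∈ J, restrictedMaximal d ψ j X f x ^ p
      ≤ ∑ x ∈ J, ENNReal.ofReal (2 ^ p) * ENNReal.ofReal (‖modulatedSum d ψ j (l x) f x‖ ^ p) := by
        refine Finset.sum_le_sum fun x _ => ?_
        rw [← hen, ← ENNReal.ofReal_rpow_of_nonneg (by norm_num) hp.le,
          ← ENNReal.mul_rpow_of_nonneg _ _ hp.le]
        gcongr
        simpa using hle x
    _ = ENNReal.ofReal (2 ^ p * ∑ x ∈ J, ‖modulatedSum d ψ j (l x) f x‖ ^ p) := by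
        rw [← Finset.mul_sum, ENNReal.ofReal_mul (by positivity),
          ENNReal.ofReal_sum_of_nonneg fun _ _ => by positivity]
    _ ≤ ENNReal.ofReal (2 ^ p * (c * ∑ y ∈ Y, ‖f y‖ ^ p)) := by
        gcongr
        exact h l hl
    _ = _ := by
        rw [← mul_assoc, ENNReal.ofReal_mul (by positivity),
          ENNReal.ofReal_sum_of_nonneg fun _ _ => by positivity]
        simp only [hen]

theorem eventually_pow_pow_le_two_pow (κ C : ℕ) :
    ∀ᶠ j : ℕ in Filter.atTop, (j ^ κ) ^ C ≤ 2 ^ j := by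
  have h := (tendsto_pow_const_div_const_pow_of_one_lt (κ * C) (r := (2 : ℝ))
    (by norm_num)).eventually (gt_mem_nhds one_pos)
  filter_upwards [h] with j hj
  rw [div_lt_one (by positivity)] at hj
  rw [← pow_mul]
  exact_mod_cast hj.le

/-- The trivial bound is uniform in the frequency. Finiteness is what allows half of the supremum to
be attained. -/
theorem restrictedMaximal_ne_top {D : ℕ} {ψ : ℝ → ℝ} (hψ : IsBumpBound D ψ) (d j : ℕ) (X : Set ℝ)
    (f : ℤ → ℂ) (x : ℤ) : restrictedMaximal d ψ j X f x ≠ ⊤ := by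
  refine ne_top_of_le_ne_top ENNReal.ofReal_ne_top (b := ENNReal.ofReal
    (4 * (D : ℝ) ^ 3 / (2 ^ j : ℕ) * ∑ y ∈ wideWindow D (2 ^ j) x, ‖f y‖)) ?_
  refine iSup₂_le fun l _ => ?_
  have hx : x ∈ window (2 ^ j) x := by
    have : (0 : ℤ) < (2 ^ j : ℕ) := by positivity
    rw [window, Finset.mem_Ico]
    omega
  rw [← ofReal_norm]
  refine ENNReal.ofReal_le_ofReal ?_
  rw [hψ.modulatedSum_eq (fun _ => l) f hx]
  exact (hψ.isWindowKernel d j _ x).norm_sum_le f hx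

/-- The Schur bound with Q = j^{κ+1} feeds `exists_window_gain` with T = j. How large j must be
depends on A, B and D, but the exponent C₀ does not. -/
theorem exists_window_bound (k : ℕ) {p : ℝ} (hp : 1 < p) : ∃ C₀ : ℝ, ∀ C : ℝ, C₀ ≤ C →
    ∀ A B : ℝ, 0 < A → 0 < B → ∀ (D : ℕ) (ψ : ℝ → ℝ), IsBumpBound D ψ →
      ∃ c : ℝ, 0 < c ∧ ∀ j : ℕ, 1 ≤ j → ∀ B' : ℝ, B ≤ B' → ∀ l : ℤ → ℝ,
        (∀ x, l x ∉ exceptionalSet (k + 2) C A B' j) → ∀ (b : ℤ) (f : ℤ → ℂ),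
          ∑ x ∈ window (2 ^ j) b, ‖modulatedSum (k + 2) ψ j (l x) f x‖ ^ p ≤
            c * (j : ℝ) ^ (-(2 * p)) * ∑ y ∈ wideWindow D (2 ^ j) b, ‖f y‖ ^ p := by
  obtain ⟨κ, hκ⟩ := exists_window_gain hp
  obtain ⟨C₁, hC₁⟩ := exists_schur_bound k
  -- Q^{C₁} is j^{(κ+1)C₁}; the extra power of j beats 1/A and 1/B once j is large.
  refine ⟨((κ + 1) * C₁ + 1 : ℕ), fun C hC A B hA hB D ψ hψ => ?_⟩
  have hD : (1 : ℝ) ≤ D := by exact_mod_cast hψ.one_le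
  have hD3 : 1 ≤ (D : ℝ) ^ 3 := one_le_pow₀ hD
  set E : ℝ := 4 * (D : ℝ) ^ 3 with hE
  have hE1 : 1 ≤ E := by linarith
  have hE0 : 0 < E := by linarith
  obtain ⟨c₁, hc₁, hgain⟩ := hκ E hE1
  obtain ⟨j₀, hj₀⟩ := Filter.eventually_atTop.1
    ((eventually_pow_pow_le_two_pow (κ + 1) C₁).and
      ((Filter.eventually_ge_atTop (2 * D ^ 2)).and
        ((tendsto_natCast_atTop_atTop.eventually_ge_atTop (1 / A)).and
          (tendsto_natCast_atTop_atTop.eventually_ge_atTop (1 / B)))))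
  -- For j < j₀ the trivial bound is used, and this constant offsets the loss of j^{-2p}.
  set c₂ : ℝ := E ^ (2 * p - 1) * ((j₀ : ℝ) + 1) ^ (2 * p) with hc₂
  have hc₂0 : 0 < c₂ := by positivity
  refine ⟨c₁ + c₂, by positivity, fun j hj B' hB' l hl b f => ?_⟩
  have hj' : (1 : ℝ) ≤ j := by exact_mod_cast hj
  have hj0 : (0 : ℝ) < j := by linarith
  have hNpos : (0 : ℝ) < (2 ^ j : ℕ) := by positivity
  have hker := hψ.isWindowKernel (k + 2) j l b
  have hF : 0 ≤ ∑ y ∈ wideWindow D (2 ^ j) b, ‖f y‖ ^ p :=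
    Finset.sum_nonneg fun _ _ => by positivity
  rw [Finset.sum_congr rfl fun x hx => by rw [hψ.modulatedSum_eq l f hx]]
  rcases le_or_gt j₀ j with hjj | hjj
  · obtain ⟨h1, h2, h3, h4⟩ := hj₀ j hjj
    have hpow : (j : ℝ) * (((j ^ (κ + 1) : ℕ) : ℝ) ^ C₁) ≤ (j : ℝ) ^ C := by
      calc (j : ℝ) * (((j ^ (κ + 1) : ℕ) : ℝ) ^ C₁)
          = (j : ℝ) ^ (((κ + 1) * C₁ + 1 : ℕ) : ℝ) := by
            rw [Real.rpow_natCast]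
            push_cast
            rw [← pow_mul, pow_succ']
        _ ≤ _ := Real.rpow_le_rpow_of_exponent_le hj' hC
    have hlarge : ∀ a : ℝ, 0 < a → 1 / a ≤ j →
        ((j ^ (κ + 1) : ℕ) : ℝ) ^ C₁ ≤ a * (j : ℝ) ^ C := by
      intro a ha haj
      rw [div_le_iff₀ ha] at haj
      have h0 : 0 ≤ ((j ^ (κ + 1) : ℕ) : ℝ) ^ C₁ := by positivity
      calc _ ≤ (j * a) * ((j ^ (κ + 1) : ℕ) : ℝ) ^ C₁ := le_mul_of_one_le_left h0 haj
        _ = a * (j * ((j ^ (κ + 1) : ℕ) : ℝ) ^ C₁) := by ring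
        _ ≤ _ := by gcongr
    have hQ : 2 * D ^ 2 ≤ j ^ (κ + 1) := h2.trans (Nat.le_self_pow (by omega) j)
    have hschur := hC₁ D ψ hψ (j ^ (κ + 1)) j hQ h1 l (fun x q hq hq' =>
      not_nearInt_of_notMem_exceptionalSet (hl x) hq (by exact_mod_cast hq') (hlarge A hA h3)
        ((hlarge B hB h4).trans (by gcongr))) b
    have hl2 : ∀ g : ℤ → ℂ, ∑ x ∈ window (2 ^ j) b,
        ‖∑ y ∈ wideWindow D (2 ^ j) b, modulatedMatrix (k + 2) ψ j l x y * g y‖ ^ 2 ≤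
          E / (j : ℝ) ^ κ * ∑ y ∈ wideWindow D (2 ^ j) b, ‖g y‖ ^ 2 := by
      intro g
      refine (sum_norm_sq_le_of_schur (by positivity) hschur g).trans ?_
      have : 0 ≤ ∑ y ∈ wideWindow D (2 ^ j) b, ‖g y‖ ^ 2 :=
        Finset.sum_nonneg fun _ _ => by positivity
      push_cast
      gcongr
      omega
    refine (hgain _ j hNpos hj' _ _ _ hker hl2 f).trans ?_
    gcongr
    linarith
  · refine (hker.sum_rpow_le hE1 hNpos hp f).trans ?_
    gcongr
    have h1 : (j : ℝ) ≤ j₀ + 1 := by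
      have : (j : ℝ) ≤ j₀ := by exact_mod_cast hjj.le
      linarith
    have h2 : 1 ≤ ((j₀ : ℝ) + 1) ^ (2 * p) * (j : ℝ) ^ (-(2 * p)) := by
      rw [Real.rpow_neg hj0.le, ← div_eq_mul_inv, one_le_div (by positivity)]
      gcongr
    calc E ^ (2 * p - 1) ≤
          E ^ (2 * p - 1) * (((j₀ : ℝ) + 1) ^ (2 * p) * (j : ℝ) ^ (-(2 * p))) :=
          le_mul_of_one_le_right (by positivity) h2
      _ = c₂ * (j : ℝ) ^ (-(2 * p)) := by rw [hc₂]; ring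
      _ ≤ _ := by
          gcongr
          linarith

theorem eLpNorm_count_le {M : ℤ → ℝ≥0∞} {f : ℤ → ℂ} {p c : ℝ} (hp : 0 < p) (hc : 0 ≤ c)
    (h : ∑' x, M x ^ p ≤ ENNReal.ofReal (c ^ p) * ∑' y, ‖f y‖ₑ ^ p) :
    eLpNorm M (ENNReal.ofReal p) Measure.count ≤
      ENNReal.ofReal c * eLpNorm f (ENNReal.ofReal p) Measure.count := by
  have hp0 : ENNReal.ofReal p ≠ 0 := by simpa using hp
  rw [eLpNorm_eq_lintegral_rpow_enorm_toReal hp0 ENNReal.ofReal_ne_top,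
    eLpNorm_eq_lintegral_rpow_enorm_toReal hp0 ENNReal.ofReal_ne_top,
    ENNReal.toReal_ofReal hp.le, lintegral_count, lintegral_count]
  simp only [enorm_eq_self]
  calc (∑' x, M x ^ p) ^ (1 / p) ≤ (ENNReal.ofReal (c ^ p) * ∑' y, ‖f y‖ₑ ^ p) ^ (1 / p) := by
        gcongr
    _ = _ := by
        rw [ENNReal.mul_rpow_of_nonneg _ _ (by positivity),
          ← ENNReal.ofReal_rpow_of_nonneg hc hp.le, ← ENNReal.rpow_mul,
          mul_one_div_cancel hp.ne', ENNReal.rpow_one]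

theorem mainTheorem4 (d : ℕ) (hd : 2 ≤ d) (p : ℝ) (hp : 1 < p) :
    ∃ C₀ : ℝ, ∀ C : ℝ, C₀ ≤ C → ∀ A B : ℝ, 0 < A → 0 < B →
      ∀ ψ : ℝ → ℝ, ContDiff ℝ ∞ ψ → HasCompactSupport ψ → (∀ t, ψ (-t) = -ψ t) →
        ∃ K : ℝ, 0 < K ∧ ∀ j : ℕ, 1 ≤ j → ∀ B' : ℝ, B ≤ B' → B' ≤ 2 * B → ∀ f : ℤ → ℂ,
          eLpNorm (restrictedMaximal d ψ j (exceptionalSet d C A B' j) f)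
              (ENNReal.ofReal p) Measure.count ≤
            ENNReal.ofReal (K / (j : ℝ) ^ 2) * eLpNorm f (ENNReal.ofReal p) Measure.count := by
  obtain ⟨k, rfl⟩ := Nat.exists_eq_add_of_le' hd
  have hp0 : 0 < p := by linarith
  obtain ⟨C₀, hC₀⟩ := exists_window_bound k hp
  refine ⟨C₀, fun C hC A B hA hB ψ hψ hψc _ => ?_⟩
  obtain ⟨D, hD⟩ := exists_isBumpBound hψ hψc
  obtain ⟨c, hc, hbound⟩ := hC₀ C hC A B hA hB D ψ hD
  set K₀ : ℝ := 2 ^ p * c * (2 * D + 1 : ℕ) with hK₀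
  have hK₀pos : 0 < K₀ := by positivity
  -- The window estimates concern p-th powers: 2^p comes from the near-maximal choice of frequency
  -- and 2D + 1 from the overlap of windows. The p-th root turns j^{-2p} into j⁻².
  refine ⟨K₀ ^ (1 / p), by positivity, fun j hj B' hB' _ f => ?_⟩
  have hj0 : (0 : ℝ) < j := by exact_mod_cast hj
  refine eLpNorm_count_le hp0 (by positivity) ?_
  have hwin : ∀ b, ∑ x ∈ window (2 ^ j) b,
      restrictedMaximal (k + 2) ψ j (exceptionalSet (k + 2) C A B' j) f x ^ p ≤
      ENNReal.ofReal (2 ^ p * (c * (j : ℝ) ^ (-(2 * p)))) *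
        ∑ y ∈ wideWindow D (2 ^ j) b, ‖f y‖ₑ ^ p := fun b =>
    sum_iSup_rpow_le hp0 (by positivity) (restrictedMaximal_ne_top hD _ _ _ f)
      fun l hl => hbound j hj B' hB' l hl b f
  refine (tsum_le_of_window Nat.one_le_two_pow hwin).trans_eq ?_
  congr 1
  rw [← ENNReal.ofReal_natCast, ← ENNReal.ofReal_mul (by positivity)]
  congr 1
  rw [Real.div_rpow (by positivity) (by positivity), ← Real.rpow_mul hK₀pos.le,
    one_div_mul_cancel hp0.ne', Real.rpow_one, ← Real.rpow_natCast, ← Real.rpow_mul hj0.le,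
    Real.rpow_neg hj0.le, hK₀]
  push_cast
  ring
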